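/- Let $d\ge 2$ be fixed. A $d$-norm is a norm on $\mathbb{R}^d$; the set of all $d$-norms is metrized by letting the distance of two norms be the Hausdorff distance (with respect to the Euclidean metric) of their closed unit balls. For a $d$-norm $\|\cdot\|$ let $D_{\|\cdot\|}(n)$ be the minimum, over all sets $P\subset\mathbb{R}^d$ of $n$ distinct points, of the number of distinct values $\|x-y\|$ with $x,y\in P$, $x\ne y$. There are a function $\varepsilon:\mathbb{N}\to\mathbb{R}$, depending only on $d$, with $\varepsilon(n)\to 0$ as $n\to\infty$, and a meagre set $S$ of $d$-norms, such that for every $d$-norm $\|\cdot\|\notin S$ the following holds: for every $n$, any $n$ distinct points in $\mathbb{R}^d$ determine at least $(1-\varepsilon(n))\,n$ distinct distances according to $\|\cdot\|$, and $D_{\|\cdot\|}(n)=(1-o(1))\,n$ as $n\to\infty$. In particular, for every $d\ge 2$ there is a $d$-norm for which $D_{\|\cdot\|}(n)=o(n)$ fails, contrary to a conjecture of Brass. -/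

import Mathlib

open Filter Topology Asymptotics

/-- Euclidean `d`-space. Its Euclidean metric is used only to define the Hausdorff distance
between unit balls. -/
abbrev Pt (d : ℕ) : Type := EuclideanSpace ℝ (Fin d)

/-- A `d`-norm: an arbitrary norm on `ℝ^d`, i.e. a seminorm that vanishes only at `0`. -/
structure DNorm (d : ℕ) extends Seminorm ℝ (Pt d) where
  eq_zero_of_map_eq_zero' : ∀ x : Pt d, toFun x = 0 → x = 0

namespace DNorm

/-- The value `‖x‖` of the `d`-norm `N` at `x`. -/
def val {d : ℕ} (N : DNorm d) (x : Pt d) : ℝ := N.toSeminorm x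

/-- The unit ball `{x : ‖x‖ ≤ 1}` of a `d`-norm. -/
def unitBall {d : ℕ} (N : DNorm d) : Set (Pt d) := {x | N.val x ≤ 1}

theorem unitBall_nonempty {d : ℕ} (N : DNorm d) : N.unitBall.Nonempty :=
  ⟨0, by simp [unitBall, val]⟩

theorem continuous_val {d : ℕ} (N : DNorm d) : Continuous N.val := by
  have h : ConvexOn ℝ Set.univ N.val := N.toSeminorm.convexOn
  exact continuousOn_univ.1 (h.continuousOn isOpen_univ)

theorem isClosed_unitBall {d : ℕ} (N : DNorm d) : IsClosed N.unitBall :=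
  isClosed_le N.continuous_val continuous_const

theorem isBounded_unitBall {d : ℕ} (N : DNorm d) : Bornology.IsBounded N.unitBall := by
  rcases (Metric.sphere (0 : Pt d) 1).eq_empty_or_nonempty with he | hne
  · refine (Bornology.isBounded_singleton (x := (0 : Pt d))).subset fun x _ => ?_
    by_contra hx
    have hx0 : ‖x‖ ≠ 0 := norm_ne_zero_iff.2 hx
    have : (‖x‖⁻¹ • x) ∈ Metric.sphere (0 : Pt d) 1 := by
      simp [norm_smul, hx0]
    simp [he] at this
  · obtain ⟨z, hz, hmin⟩ := (isCompact_sphere (0 : Pt d) 1).exists_isMinOn hne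
      N.continuous_val.continuousOn
    have hz0 : z ≠ 0 := by
      rintro rfl
      simp at hz
    have hpos : 0 < N.val z :=
      lt_of_le_of_ne (apply_nonneg N.toSeminorm z)
        fun h => hz0 (N.eq_zero_of_map_eq_zero' z h.symm)
    refine (Metric.isBounded_closedBall (x := (0 : Pt d)) (r := (N.val z)⁻¹)).subset fun x hx => ?_
    rw [mem_closedBall_zero_iff]
    by_cases hx0 : x = 0
    · simp [hx0, hpos.le]
    have hxn : 0 < ‖x‖ := norm_pos_iff.2 hx0
    have hm : (‖x‖⁻¹ • x) ∈ Metric.sphere (0 : Pt d) 1 := by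
      simp [norm_smul, hxn.ne']
    have h1 : N.val z ≤ N.val (‖x‖⁻¹ • x) := hmin hm
    have h2 : N.val (‖x‖⁻¹ • x) = ‖x‖⁻¹ * N.val x := by
      simp [val, map_smul_eq_mul]
    have h3 : N.val x ≤ 1 := hx
    have h4 : N.val z ≤ ‖x‖⁻¹ := by
      rw [h2] at h1
      exact h1.trans (mul_le_of_le_one_right (inv_nonneg.2 hxn.le) h3)
    exact (le_inv_comm₀ hpos hxn).1 h4

theorem hausdorffEDist_ne_top {d : ℕ} (N M : DNorm d) :
    Metric.hausdorffEDist N.unitBall M.unitBall ≠ ⊤ :=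
  Metric.hausdorffEDist_ne_top_of_nonempty_of_bounded N.unitBall_nonempty M.unitBall_nonempty
    N.isBounded_unitBall M.isBounded_unitBall

theorem eq_of_unitBall_eq {d : ℕ} {N M : DNorm d} (h : N.unitBall = M.unitBall) : N = M := by
  have key : ∀ A B : DNorm d, A.unitBall = B.unitBall → ∀ x, B.val x ≤ A.val x := by
    intro A B hAB x
    by_cases hx : x = 0
    · simp [hx, val]
    have hpos : 0 < A.val x :=
      lt_of_le_of_ne (apply_nonneg A.toSeminorm x)
        fun h => hx (A.eq_zero_of_map_eq_zero' x h.symm)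
    have hs : ∀ C : DNorm d, C.val ((A.val x)⁻¹ • x) = (A.val x)⁻¹ * C.val x := by
      intro C
      simp [val, map_smul_eq_mul, abs_of_nonneg]
    have hm : (A.val x)⁻¹ • x ∈ A.unitBall := by
      change A.val _ ≤ 1
      rw [hs, inv_mul_cancel₀ hpos.ne']
    rw [hAB] at hm
    change B.val _ ≤ 1 at hm
    rw [hs, inv_mul_le_iff₀ hpos, mul_one] at hm
    exact hm
  have hS : N.toSeminorm = M.toSeminorm :=
    Seminorm.ext fun x => le_antisymm (key M N h.symm x) (key N M h x)
  cases N
  cases M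
  cases hS
  rfl

/-- The space of all `d`-norms, metrized by the Hausdorff distance (with respect to the Euclidean
metric) of their unit balls. -/
noncomputable instance instMetricSpace {d : ℕ} : MetricSpace (DNorm d) where
  dist N M := Metric.hausdorffDist N.unitBall M.unitBall
  dist_self _ := Metric.hausdorffDist_self_zero
  dist_comm _ _ := Metric.hausdorffDist_comm
  dist_triangle N M _ := Metric.hausdorffDist_triangle (hausdorffEDist_ne_top N M)
  eq_of_dist_eq_zero {N M} h := eq_of_unitBall_eq <|
    (N.isClosed_unitBall.hausdorffDist_zero_iff_eq M.isClosed_unitBall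
      (hausdorffEDist_ne_top N M)).1 h

/-- The number of distinct distances, according to `N`, between two different points of the
finite set `P`. -/
noncomputable def numDistances {d : ℕ} (N : DNorm d) (P : Finset (Pt d)) : ℕ :=
  Set.ncard {r : ℝ | ∃ x ∈ P, ∃ y ∈ P, x ≠ y ∧ N.val (x - y) = r}

/-- `D(n)`: the minimum number of distinct distances, according to `N`, determined by a set of
`n` points of `ℝ^d`. -/
noncomputable def minDistances {d : ℕ} (N : DNorm d) (n : ℕ) : ℕ :=
  sInf {k : ℕ | ∃ P : Finset (Pt d), P.card = n ∧ N.numDistances P = k}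

end DNorm

/-! Let `P` be `n` points with `D` distinct distances, `F` the subfield of ℝ generated by these
distances, and `W` the `F`-span of the differences of points of `P`, with `k = dim_F W`. A
difference divided by its own length stays in `W`, so each direction of `P` gives a unit vector in
`W`. These unit vectors are combinations of `k` basis vectors in ℝ^d with coefficients rational in
`D` real numbers: the configuration has `dk + D` degrees of freedom, and each unit vector imposes
one condition. A generic norm therefore admits at most `dk + D` of them up to sign
(`card_unitVectors_le`).

If `P` is not collinear, it has at least `n - 1` directions
(`Ungar.card_le_card_directions_add_one`), so `n - 1 ≤ dk + D`. On the other hand the `k(k-1)`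
ordered differences of basis vectors have different directions over `F`, so `k(k-1) ≤ 2(dk + D)`. If
`D ≤ n` this forces `k = O(√n)` and `D ≥ n - O(√n)`. Collinear points have `n - 1` distances from an
end point already, and an arithmetic progression shows that `n` distances suffice.

Genericity: after clearing denominators there are countably many systems of integer polynomials.
Bounding the parameters and separating the unit vectors makes each bad set closed. It is nowhere
dense, because every norm is close to polyhedral norms with small facets whose heights vary
independently (`exists_polyhedral_approx`): separated unit vectors lie on different facets, so `dk +
m + 1` heights would be smooth functions of `dk + m` parameters, which fails for most heights by
dimension. A norm outside the meagre set exists since the space of norms is Baire. -/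

namespace DNorm

/-! ### Norm inequalities versus the Hausdorff metric -/

variable {d : ℕ}

theorem val_nonneg (N : DNorm d) (x : Pt d) : 0 ≤ N.val x := apply_nonneg N.toSeminorm x

theorem val_zero (N : DNorm d) : N.val 0 = 0 := map_zero N.toSeminorm

theorem val_smul (N : DNorm d) (a : ℝ) (x : Pt d) : N.val (a • x) = |a| * N.val x := by
  simp [val, map_smul_eq_mul]

theorem val_add_le (N : DNorm d) (x y : Pt d) : N.val (x + y) ≤ N.val x + N.val y :=
  map_add_le_add N.toSeminorm x y

theorem val_neg (N : DNorm d) (x : Pt d) : N.val (-x) = N.val x := map_neg_eq_map N.toSeminorm x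

theorem val_pos (N : DNorm d) {x : Pt d} (hx : x ≠ 0) : 0 < N.val x :=
  lt_of_le_of_ne (N.val_nonneg x) fun h => hx (N.eq_zero_of_map_eq_zero' x h.symm)

theorem val_sub_le (N : DNorm d) (x y : Pt d) : N.val x - N.val y ≤ N.val (x - y) := by
  have := N.val_add_le (x - y) y
  rw [sub_add_cancel] at this
  linarith

theorem val_inv_smul_self (N : DNorm d) {x : Pt d} (hx : x ≠ 0) :
    N.val ((N.val x)⁻¹ • x) = 1 := by
  rw [val_smul, abs_of_nonneg (inv_nonneg.2 (N.val_nonneg x)), inv_mul_cancel₀ (N.val_pos hx).ne']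

/-- A homogeneous inequality between two norms can be checked on the unit ball of one of them. -/
theorem val_le_mul_of_unitBall (N M : DNorm d) {c : ℝ}
    (h : ∀ x, N.val x ≤ 1 → M.val x ≤ c) (x : Pt d) : M.val x ≤ c * N.val x := by
  by_cases hx : x = 0
  · simp [hx, val_zero]
  have h1 := h _ (N.val_inv_smul_self hx).le
  rwa [val_smul, abs_of_nonneg (inv_nonneg.2 (N.val_nonneg x)),
    inv_mul_le_iff₀ (N.val_pos hx), mul_comm] at h1

/-- The Euclidean norm. -/
noncomputable def euclidean (d : ℕ) : DNorm d where
  toSeminorm := normSeminorm ℝ (Pt d)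
  eq_zero_of_map_eq_zero' _ hx := norm_eq_zero.1 hx

theorem euclidean_val (x : Pt d) : (euclidean d).val x = ‖x‖ := rfl

theorem exists_norm_le (N : DNorm d) : ∃ C : ℝ, 0 < C ∧ ∀ x, ‖x‖ ≤ C * N.val x := by
  obtain ⟨C, hC⟩ := N.isBounded_unitBall.exists_norm_le
  refine ⟨max C 1, by positivity, fun x => ?_⟩
  exact N.val_le_mul_of_unitBall (euclidean d) (c := max C 1)
    (fun y hy => (hC y hy).trans (le_max_left _ _)) x

theorem isCompact_unitBall (N : DNorm d) : IsCompact N.unitBall :=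
  Metric.isCompact_of_isClosed_isBounded N.isClosed_unitBall N.isBounded_unitBall

theorem exists_val_le (N M : DNorm d) : ∃ C : ℝ, 0 < C ∧ ∀ x, N.val x ≤ C * M.val x := by
  obtain ⟨z, -, hz⟩ := M.isCompact_unitBall.exists_isMaxOn M.unitBall_nonempty
    N.continuous_val.continuousOn
  refine ⟨max (N.val z) 1, by positivity, M.val_le_mul_of_unitBall N fun y hy => ?_⟩
  exact (hz hy).trans (le_max_left _ _)

/-- Scaling by `(1 + κ)⁻¹` maps each unit ball into the other and moves points by at most `κ * R`.
-/
theorem dist_le_of_val_le (N M : DNorm d) {κ R : ℝ} (hκ : 0 ≤ κ) (hR : ∀ x, ‖x‖ ≤ R * N.val x)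
    (hR0 : 0 ≤ R)
    (h1 : ∀ x, M.val x ≤ (1 + κ) * N.val x) (h2 : ∀ x, N.val x ≤ (1 + κ) * M.val x) :
    dist N M ≤ κ * R := by
  have hk : 0 < 1 + κ := by linarith
  have key : ∀ x : Pt d, dist x ((1 + κ)⁻¹ • x) = κ * ‖(1 + κ)⁻¹ • x‖ := by
    intro x
    have : x - (1 + κ)⁻¹ • x = κ • (1 + κ)⁻¹ • x := by
      have : x = (1 + κ) • (1 + κ)⁻¹ • x := by rw [smul_inv_smul₀ hk.ne']
      nth_rewrite 1 [this]
      module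
    rw [dist_eq_norm, this, norm_smul, Real.norm_of_nonneg hκ]
  have hs : ∀ (A : DNorm d) (x : Pt d), A.val ((1 + κ)⁻¹ • x) = (1 + κ)⁻¹ * A.val x := by
    intro A x
    rw [val_smul, abs_of_nonneg (inv_nonneg.2 hk.le)]
  refine Metric.hausdorffDist_le_of_mem_dist (by positivity) ?_ ?_
  · intro x hx
    refine ⟨(1 + κ)⁻¹ • x, ?_, ?_⟩
    · change M.val _ ≤ 1
      rw [hs, inv_mul_le_iff₀ hk]
      have hx : N.val x ≤ 1 := hx
      nlinarith [h1 x]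
    · rw [key]
      refine mul_le_mul_of_nonneg_left ?_ hκ
      refine (hR _).trans ?_
      rw [hs]
      have hx : N.val x ≤ 1 := hx
      have : (1 + κ)⁻¹ ≤ 1 := inv_le_one_of_one_le₀ (by linarith)
      have : (1 + κ)⁻¹ * N.val x ≤ 1 := mul_le_one₀ this (N.val_nonneg x) hx
      nlinarith
  · intro x hx
    have hx : M.val x ≤ 1 := hx
    have hm : N.val ((1 + κ)⁻¹ • x) ≤ 1 := by
      rw [hs, inv_mul_le_iff₀ hk]
      nlinarith [h2 x]
    refine ⟨(1 + κ)⁻¹ • x, hm, ?_⟩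
    rw [key]
    refine mul_le_mul_of_nonneg_left ?_ hκ
    refine (hR _).trans ?_
    nlinarith

theorem exists_dist_lt_val_le (N : DNorm d) {κ : ℝ} (hκ : 0 < κ) :
    ∃ δ > 0, ∀ M : DNorm d, dist M N < δ →
      (∀ x, M.val x ≤ (1 + κ) * N.val x) ∧ (∀ x, N.val x ≤ (1 + κ) * M.val x) := by
  obtain ⟨C, hC, hNC⟩ := N.exists_val_le (euclidean d)
  simp only [euclidean_val] at hNC
  set η := κ / (1 + κ) with hη
  have hη0 : 0 < η := by positivity
  have hη1 : η < 1 := by rw [hη, div_lt_one (by positivity)]; linarith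
  have hηκ : η ≤ κ := div_le_self hκ.le (by linarith)
  refine ⟨η / C, by positivity, fun M hM => ?_⟩
  have hM' : Metric.hausdorffDist M.unitBall N.unitBall < η / C := hM
  have hsmall : ∀ x : Pt d, ‖x‖ < η / C → N.val x ≤ η := by
    intro x hx
    have := hNC x
    rw [lt_div_iff₀ hC] at hx
    linarith
  constructor
  -- The maximum of `M` over the ball of `N` bounds itself: `M z ≤ 1 + M (z - y) ≤ 1 + η * M z`, and
  -- `1 - η = (1 + κ)⁻¹`.
  · obtain ⟨z, hzN, hz⟩ := N.isCompact_unitBall.exists_isMaxOn N.unitBall_nonempty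
      M.continuous_val.continuousOn
    have hmax := N.val_le_mul_of_unitBall M (c := M.val z) (fun x hx => hz hx)
    obtain ⟨y, hy, hyz⟩ := Metric.exists_dist_lt_of_hausdorffDist_lt' hzN hM'
      (hausdorffEDist_ne_top M N)
    have hy : M.val y ≤ 1 := hy
    have h1 : N.val (z - y) ≤ η := hsmall _ (by rwa [← dist_eq_norm, dist_comm])
    have h2 := M.val_sub_le z y
    have h3 := hmax (z - y)
    have h5 : M.val z * N.val (z - y) ≤ M.val z * η :=
      mul_le_mul_of_nonneg_left h1 (M.val_nonneg z)
    have h6 : M.val z * (1 - η) ≤ 1 := by nlinarith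
    have h7 : 1 - η = (1 + κ)⁻¹ := by rw [hη]; field_simp; ring
    have h8 : M.val z ≤ 1 + κ := by
      rw [h7, ← div_eq_mul_inv, div_le_one (by positivity)] at h6
      exact h6
    intro x
    exact (hmax x).trans (mul_le_mul_of_nonneg_right h8 (N.val_nonneg x))
  · refine M.val_le_mul_of_unitBall N fun x hx => ?_
    obtain ⟨y, hy, hyx⟩ := Metric.exists_dist_lt_of_hausdorffDist_lt (x := x) (s := M.unitBall) hx hM'
      (hausdorffEDist_ne_top M N)
    have hy : N.val y ≤ 1 := hy
    have h1 : N.val (x - y) ≤ η := hsmall _ (by rwa [← dist_eq_norm])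
    have h2 := N.val_sub_le x y
    linarith

theorem continuous_val_uncurry : Continuous fun p : DNorm d × Pt d => p.1.val p.2 := by
  rw [continuous_iff_continuousAt]
  rintro ⟨N, x⟩
  rw [ContinuousAt, Metric.tendsto_nhds]
  intro ε hε
  set B := N.val x + 1 with hB
  have hB0 : 0 < B := by have := N.val_nonneg x; positivity
  set κ := min 1 (ε / (8 * B)) with hκdef
  have hκ : 0 < κ := by positivity
  have hκ1 : κ ≤ 1 := min_le_left _ _
  have hκε : κ * (8 * B) ≤ ε := by
    rw [← le_div_iff₀ (by positivity)]
    exact min_le_right _ _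
  obtain ⟨δ, hδ, hNM⟩ := N.exists_dist_lt_val_le hκ
  have e1 : ∀ᶠ p : DNorm d × Pt d in 𝓝 (N, x), dist p.1 N < δ :=
    (continuous_fst.tendsto (N, x)).eventually (Metric.ball_mem_nhds N hδ)
  have e2 : ∀ᶠ p : DNorm d × Pt d in 𝓝 (N, x), dist (N.val p.2) (N.val x) < min 1 (ε / 2) :=
    ((N.continuous_val.comp continuous_snd).tendsto (N, x)).eventually
      (Metric.ball_mem_nhds _ (by positivity))
  filter_upwards [e1, e2] with p h1 h2
  obtain ⟨ha, hb⟩ := hNM p.1 h1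
  have ha := ha p.2
  have hb := hb p.2
  rw [Real.dist_eq, abs_lt] at *
  have m1 : min 1 (ε / 2) ≤ 1 := min_le_left _ _
  have m2 : min 1 (ε / 2) ≤ ε / 2 := min_le_right _ _
  have hy : N.val p.2 ≤ B := by linarith [h2.2]
  have hy0 := N.val_nonneg p.2
  have hM0 := p.1.val_nonneg p.2
  have k1 : κ * N.val p.2 ≤ κ * B := mul_le_mul_of_nonneg_left hy hκ.le
  have k2 : κ * p.1.val p.2 ≤ κ * (2 * B) := by
    refine mul_le_mul_of_nonneg_left ?_ hκ.le
    nlinarith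
  constructor <;> nlinarith [h2.1, h2.2]

/-! ### The space of norms is a Baire space -/

/-- The logarithm of a `d`-norm on the Euclidean unit sphere. -/
noncomputable def logOnSphere (N : DNorm d) : C(Metric.sphere (0 : Pt d) 1, ℝ) where
  toFun x := Real.log (N.val x)
  continuous_toFun := by
    refine Continuous.log (N.continuous_val.comp continuous_subtype_val) fun x => ?_
    exact (N.val_pos (ne_zero_of_mem_unit_sphere x)).ne'

/-- The positively homogeneous extension to `ℝ^d` of the exponential of a function on the sphere. -/
noncomputable def expExtension (f : C(Metric.sphere (0 : Pt d) 1, ℝ)) (x : Pt d) : ℝ :=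
  open Classical in
  if h : x = 0 then 0 else ‖x‖ * Real.exp (f ⟨‖x‖⁻¹ • x, by simp [norm_smul, h]⟩)

theorem continuous_expExtension (x : Pt d) :
    Continuous fun f : C(Metric.sphere (0 : Pt d) 1, ℝ) => expExtension f x := by
  unfold expExtension
  by_cases h : x = 0
  · simp only [h, dite_true]; exact continuous_const
  · simp only [h, dite_false]
    exact continuous_const.mul (Real.continuous_exp.comp (continuous_eval_const _))

theorem expExtension_logOnSphere (N : DNorm d) (x : Pt d) :
    expExtension N.logOnSphere x = N.val x := by
  unfold expExtension
  split_ifs with h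
  · rw [h, val_zero]
  · have hx : 0 < ‖x‖ := norm_pos_iff.2 h
    have h0 : ‖x‖⁻¹ • x ≠ 0 := smul_ne_zero (inv_ne_zero hx.ne') h
    change ‖x‖ * Real.exp (Real.log (N.val (‖x‖⁻¹ • x))) = _
    rw [Real.exp_log (N.val_pos h0), val_smul, abs_of_nonneg (inv_nonneg.2 hx.le),
      mul_inv_cancel_left₀ hx.ne']

theorem expExtension_coe_sphere (f : C(Metric.sphere (0 : Pt d) 1, ℝ))
    (x : Metric.sphere (0 : Pt d) 1) : expExtension f x = Real.exp (f x) := by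
  have h : (x : Pt d) ≠ 0 := ne_zero_of_mem_unit_sphere x
  have hx : ‖(x : Pt d)‖ = 1 := norm_eq_of_mem_sphere x
  simp [expExtension, h, hx]

/-- Subadditivity and homogeneity are closed conditions on pointwise values, and definiteness is
automatic because the exponential is positive. This is the gain from taking logarithms. -/
theorem isClosed_range_logOnSphere : IsClosed (Set.range (logOnSphere (d := d))) := by
  have : Set.range (logOnSphere (d := d)) =
      {f | ∀ x y, expExtension f (x + y) ≤ expExtension f x + expExtension f y} ∩
      {f | ∀ (a : ℝ) x, expExtension f (a • x) = |a| * expExtension f x} := by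
    ext f
    constructor
    · rintro ⟨N, rfl⟩
      simp only [Set.mem_inter_iff, Set.mem_ofPred_eq, expExtension_logOnSphere]
      exact ⟨N.val_add_le, N.val_smul⟩
    · rintro ⟨h1, h2⟩
      have hpos : ∀ x : Pt d, x ≠ 0 → 0 < expExtension f x := by
        intro x hx
        have := norm_pos_iff.2 hx
        simp only [expExtension, hx, dite_false]
        positivity
      refine ⟨⟨Seminorm.of (expExtension f) h1 (by simpa using h2), fun x hx => ?_⟩, ?_⟩
      · by_contra h
        exact (hpos x h).ne' hx
      · ext x
        change Real.log (expExtension f x) = _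
        rw [expExtension_coe_sphere, Real.log_exp]
  rw [this]
  simp only [Set.ofPred_forall]
  refine IsClosed.inter ?_ ?_
  · exact isClosed_iInter fun x => isClosed_iInter fun y =>
      isClosed_le (continuous_expExtension _)
        ((continuous_expExtension _).add (continuous_expExtension _))
  · exact isClosed_iInter fun a => isClosed_iInter fun x =>
      isClosed_eq (continuous_expExtension _) (continuous_const.mul (continuous_expExtension _))

theorem logOnSphere_injective : Function.Injective (logOnSphere (d := d)) := by
  intro N M h
  refine eq_of_unitBall_eq ?_
  ext x
  change N.val x ≤ 1 ↔ M.val x ≤ 1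
  rw [← expExtension_logOnSphere, h, expExtension_logOnSphere]

theorem continuous_logOnSphere : Continuous (logOnSphere (d := d)) := by
  refine ContinuousMap.continuous_of_continuous_uncurry _ ?_
  change Continuous fun p : DNorm d × Metric.sphere (0 : Pt d) 1 => Real.log (p.1.val p.2)
  refine Continuous.log ?_ fun p => (p.1.val_pos (ne_zero_of_mem_unit_sphere p.2)).ne'
  exact continuous_val_uncurry.comp (continuous_fst.prodMk (continuous_subtype_val.comp
    continuous_snd))

theorem val_le_of_dist_logOnSphere_le {N M : DNorm d} {κ : ℝ} (hκ : 0 ≤ κ)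
    (h : dist N.logOnSphere M.logOnSphere ≤ Real.log (1 + κ)) (x : Pt d) :
    N.val x ≤ (1 + κ) * M.val x := by
  rw [← expExtension_logOnSphere N, ← expExtension_logOnSphere M]
  unfold expExtension
  split_ifs with hx
  · simp
  · set y : Metric.sphere (0 : Pt d) 1 := ⟨‖x‖⁻¹ • x, by simp [norm_smul, hx]⟩
    have h1 := (ContinuousMap.dist_apply_le_dist y).trans h
    rw [Real.dist_eq, abs_le] at h1
    have h2 : N.logOnSphere y ≤ Real.log (1 + κ) + M.logOnSphere y := by linarith [h1.2]
    have h3 := Real.exp_le_exp.2 h2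
    rw [Real.exp_add, Real.exp_log (by linarith)] at h3
    have := norm_nonneg x
    nlinarith

/-- The Hausdorff metric itself need not be complete, since balls can degenerate. The embedding
transfers complete metrizability from the continuous functions on the sphere. -/
theorem isClosedEmbedding_logOnSphere : IsClosedEmbedding (logOnSphere (d := d)) := by
  refine ⟨⟨isInducing_iff_nhds.2 fun N => le_antisymm ?_ ?_, logOnSphere_injective⟩,
    isClosed_range_logOnSphere⟩
  · exact continuous_logOnSphere.continuousAt.tendsto.le_comap
  · rw [Metric.nhds_basis_ball.ge_iff]
    intro ε hε
    obtain ⟨R, hR, hNR⟩ := N.exists_norm_le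
    set κ := ε / (2 * R) with hκ
    have hκ0 : 0 < κ := by positivity
    refine mem_comap.2 ⟨Metric.ball N.logOnSphere (Real.log (1 + κ)),
      Metric.ball_mem_nhds _ (Real.log_pos (by linarith)), fun M hM => ?_⟩
    have hM : dist M.logOnSphere N.logOnSphere < Real.log (1 + κ) := hM
    have h1 := dist_le_of_val_le N M hκ0.le hNR hR.le
      (val_le_of_dist_logOnSphere_le hκ0.le hM.le)
      (val_le_of_dist_logOnSphere_le hκ0.le (by rw [dist_comm]; exact hM.le))
    rw [Metric.mem_ball, dist_comm]
    refine h1.trans_lt ?_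
    rw [hκ]
    field_simp
    linarith

instance instBaireSpace : BaireSpace (DNorm d) :=
  have := isClosedEmbedding_logOnSphere (d := d).IsCompletelyMetrizableSpace
  inferInstance

end DNorm

/-! ### Polyhedral approximation with small, independent facets -/

namespace DNorm

variable {d : ℕ}

theorem sqrt_add_sq_add_sq_le (a b c e : ℝ) :
    √((a + b) ^ 2 + (c + e) ^ 2) ≤ √(a ^ 2 + c ^ 2) + √(b ^ 2 + e ^ 2) := by
  have h1 : 0 ≤ a ^ 2 + c ^ 2 := by positivity
  have h2 : 0 ≤ b ^ 2 + e ^ 2 := by positivity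
  have h3 : a * b + c * e ≤ √(a ^ 2 + c ^ 2) * √(b ^ 2 + e ^ 2) := by
    rw [← Real.sqrt_mul h1]
    exact Real.le_sqrt_of_sq_le (by nlinarith [sq_nonneg (a * e - b * c)])
  rw [Real.sqrt_le_left (by positivity)]
  nlinarith [Real.sq_sqrt h1, Real.sq_sqrt h2]

/-- The uniformly convex norm `√(N(x)² + e²|x|²)`. -/
noncomputable def hilbertSum (N : DNorm d) (e : ℝ) : DNorm d where
  toSeminorm := Seminorm.of (fun x => √(N.val x ^ 2 + (e * ‖x‖) ^ 2))
    (fun x y => by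
      refine le_trans (Real.sqrt_le_sqrt ?_) (sqrt_add_sq_add_sq_le _ _ _ _)
      have h1 : N.val (x + y) ^ 2 ≤ (N.val x + N.val y) ^ 2 :=
        pow_le_pow_left₀ (N.val_nonneg _) (N.val_add_le x y) 2
      have h2 : ‖x + y‖ ^ 2 ≤ (‖x‖ + ‖y‖) ^ 2 :=
        pow_le_pow_left₀ (norm_nonneg _) (norm_add_le x y) 2
      nlinarith [sq_nonneg e])
    (fun a x => by
      rw [val_smul, norm_smul, Real.norm_eq_abs, ← Real.sqrt_sq (abs_nonneg a),
        ← Real.sqrt_mul (by positivity), Real.sqrt_sq (abs_nonneg a)]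
      congr 1
      ring)
  eq_zero_of_map_eq_zero' x hx := by
    have hx : √(N.val x ^ 2 + (e * ‖x‖) ^ 2) = 0 := hx
    rw [Real.sqrt_eq_zero (by positivity)] at hx
    by_contra h
    have := N.val_pos h
    nlinarith [sq_nonneg (e * ‖x‖)]

theorem hilbertSum_sq (N : DNorm d) (e : ℝ) (x : Pt d) :
    (N.hilbertSum e).val x ^ 2 = N.val x ^ 2 + (e * ‖x‖) ^ 2 :=
  Real.sq_sqrt (by positivity)

theorem le_hilbertSum (N : DNorm d) (e : ℝ) (x : Pt d) : N.val x ≤ (N.hilbertSum e).val x :=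
  Real.le_sqrt_of_sq_le (by nlinarith [sq_nonneg (e * ‖x‖)])

theorem hilbertSum_le (N : DNorm d) {e C : ℝ} (he : 0 ≤ e) (hC : 0 ≤ C)
    (h : ∀ x, ‖x‖ ≤ C * N.val x) (x : Pt d) :
    (N.hilbertSum e).val x ≤ (1 + e * C) * N.val x := by
  have hx := h x
  have h0 := N.val_nonneg x
  refine (Real.sqrt_le_left (by positivity)).2 ?_
  have h1 : e * ‖x‖ ≤ e * (C * N.val x) := mul_le_mul_of_nonneg_left hx he
  have h2 : (e * ‖x‖) ^ 2 ≤ (e * (C * N.val x)) ^ 2 :=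
    pow_le_pow_left₀ (by positivity) h1 2
  have h3 : 0 ≤ e * C * N.val x ^ 2 := by positivity
  nlinarith

/-- Uniform convexity of `hilbertSum`. -/
theorem hilbertSum_parallelogram (N : DNorm d) (e : ℝ) (x y : Pt d) :
    (N.hilbertSum e).val (x + y) ^ 2 + (e * ‖x - y‖) ^ 2 ≤
      2 * (N.hilbertSum e).val x ^ 2 + 2 * (N.hilbertSum e).val y ^ 2 := by
  simp only [hilbertSum_sq]
  have h1 : N.val (x + y) ^ 2 ≤ (N.val x + N.val y) ^ 2 :=
    pow_le_pow_left₀ (N.val_nonneg _) (N.val_add_le x y) 2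
  have h2 := parallelogram_law_with_norm ℝ x y
  have h3 : e ^ 2 * (‖x + y‖ ^ 2 + ‖x - y‖ ^ 2) =
    e ^ 2 * (2 * (‖x‖ ^ 2 + ‖y‖ ^ 2)) := by rw [h2]
  nlinarith [sq_nonneg (N.val x - N.val y)]

theorem exists_support_functional (N : DNorm d) {z : Pt d} (hz : z ≠ 0) :
    ∃ g : Pt d →ₗ[ℝ] ℝ, g z = N.val z ∧ ∀ x, |g x| ≤ N.val x := by
  obtain ⟨g, hg, hgN⟩ := exists_extension_of_le_sublinear
    (LinearPMap.mkSpanSingleton z (N.val z) hz) N.val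
    (fun c hc x => by rw [val_smul, abs_of_pos hc]) N.val_add_le (by
      rintro ⟨x, hx⟩
      obtain ⟨c, rfl⟩ := Submodule.mem_span_singleton.1 hx
      rw [LinearPMap.mkSpanSingleton'_apply]
      simp only [smul_eq_mul, val_smul]
      exact mul_le_mul_of_nonneg_right (le_abs_self c) (N.val_nonneg z))
  refine ⟨g, ?_, fun x => abs_le.2 ⟨?_, hgN x⟩⟩
  · have := hg ⟨z, Submodule.mem_span_singleton_self z⟩
    rw [this]
    exact LinearPMap.mkSpanSingleton_apply ..
  · have := hgN (-x)
    rw [map_neg, val_neg] at this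
    linarith

/-- The norm `max |a_f(x)| / μ_f`, for functionals `a_f` with no common zero but `0`. -/
noncomputable def polyhedral {ι : Type} [Fintype ι] (a : ι → Pt d →ₗ[ℝ] ℝ)
    (ha : ∀ x, (∀ f, a f x = 0) → x = 0) (μ : ι → ℝ) (hμ : ∀ f, 0 < μ f) : DNorm d where
  toSeminorm := (normSeminorm ℝ (ι → ℝ)).comp (LinearMap.pi fun f => (μ f)⁻¹ • a f)
  eq_zero_of_map_eq_zero' x hx := by
    have hx : ‖LinearMap.pi (fun f => (μ f)⁻¹ • a f) x‖ = 0 := hx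
    refine ha x fun f => ?_
    have := congrFun (norm_eq_zero.1 hx) f
    simpa [(hμ f).ne'] using this

section polyhedral

variable {ι : Type} [Fintype ι] {a : ι → Pt d →ₗ[ℝ] ℝ} {ha : ∀ x, (∀ f, a f x = 0) → x = 0}
  {μ : ι → ℝ} {hμ : ∀ f, 0 < μ f}

theorem polyhedral_le {x : Pt d} {r : ℝ} (hr : 0 ≤ r) (h : ∀ f, |a f x| ≤ r * μ f) :
    (polyhedral a ha μ hμ).val x ≤ r := by
  refine (pi_norm_le_iff_of_nonneg hr).2 fun f => ?_
  have : ‖(μ f)⁻¹ * a f x‖ ≤ r := by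
    rw [norm_mul, Real.norm_of_nonneg (inv_nonneg.2 (hμ f).le), inv_mul_le_iff₀ (hμ f), mul_comm]
    exact h f
  exact this

theorem le_polyhedral (x : Pt d) (f : ι) :
    |a f x| ≤ μ f * (polyhedral a ha μ hμ).val x := by
  have : ‖(μ f)⁻¹ * a f x‖ ≤ (polyhedral a ha μ hμ).val x :=
    norm_le_pi_norm (LinearMap.pi (fun f => (μ f)⁻¹ • a f) x) f
  rwa [norm_mul, Real.norm_of_nonneg (inv_nonneg.2 (hμ f).le), inv_mul_le_iff₀ (hμ f)] at this

theorem exists_eq_of_polyhedral_eq_one {x : Pt d} (h : (polyhedral a ha μ hμ).val x = 1) :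
    ∃ f, |a f x| = μ f := by
  by_contra! hne
  have hlt : ∀ f, |a f x| < μ f := fun f => by
    refine lt_of_le_of_ne ?_ (hne f)
    have := le_polyhedral (ha := ha) (hμ := hμ) x f
    rwa [h, mul_one] at this
  have : (polyhedral a ha μ hμ).val x < 1 := by
    refine (pi_norm_lt_iff one_pos).2 fun f => ?_
    have : ‖(μ f)⁻¹ * a f x‖ < 1 := by
      rw [norm_mul, Real.norm_of_nonneg (inv_nonneg.2 (hμ f).le), inv_mul_lt_iff₀ (hμ f), mul_one]
      exact hlt f
    exact this
  linarith

end polyhedral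

/-- Every norm can be approximated by polyhedral norms with small facets, which may moreover be
moved independently of each other. -/
theorem exists_polyhedral_approx (N : DNorm d) {δ η : ℝ} (hδ : 0 < δ) (hη : 0 < η) :
    ∃ (ι : Type) (_ : Fintype ι) (a : ι → Pt d →ₗ[ℝ] ℝ) (κ : ℝ), 0 < κ ∧
      ∀ μ : ι → ℝ, (∀ f, 1 < μ f ∧ μ f < 1 + κ) → ∃ M : DNorm d, dist M N < δ ∧
        (∀ u, M.val u = 1 → ∃ f, |a f u| = μ f) ∧
        ∀ f u v, M.val u = 1 → M.val v = 1 → |a f u| = μ f → |a f v| = μ f →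
          ‖u - v‖ < η ∨ ‖u + v‖ < η := by
  obtain ⟨R, hR, hNR⟩ := N.exists_norm_le
  -- Passing from `N` to `N₁` then costs `e * R * R = δ / 4` in distance.
  set e := δ / (4 * R ^ 2) with he
  have he0 : 0 < e := by positivity
  set N₁ := N.hilbertSum e with hN₁
  have hN₁N : ∀ x, N₁.val x ≤ (1 + e * R) * N.val x := N.hilbertSum_le he0.le hR.le hNR
  -- The second bound makes the polyhedral step cost at most `4 * κ * R ≤ δ / 4`; the third gives
  -- `32 * κ < (e * η / 2) ^ 2`, which keeps the facets small.
  set κ := min (1 / 2) (min (δ / (16 * R)) (e ^ 2 * η ^ 2 / 256)) with hκdef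
  have hκ : 0 < κ := by positivity
  have hκ1 : κ ≤ 1 / 2 := min_le_left _ _
  have hκ2 : κ ≤ δ / (16 * R) := (min_le_right _ _).trans (min_le_left _ _)
  have hκ3 : κ ≤ e ^ 2 * η ^ 2 / 256 := (min_le_right _ _).trans (min_le_right _ _)
  have hcpt : IsCompact {x : Pt d | N₁.val x = 1} := by
    refine N₁.isCompact_unitBall.of_isClosed_subset
      (isClosed_eq N₁.continuous_val continuous_const) fun x hx => ?_
    exact le_of_eq hx
  obtain ⟨T, hTsub, hTcov⟩ := hcpt.elim_nhds_subcover (fun z => {x | N₁.val (x - z) < κ})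
    fun z _ => by
      refine (isOpen_lt (N₁.continuous_val.comp (continuous_id.sub continuous_const))
        continuous_const).mem_nhds ?_
      change N₁.val (z - z) < κ
      rwa [sub_self, val_zero]
  have hT1 : ∀ z : T, N₁.val z = 1 := fun z => hTsub z z.2
  have hT0 : ∀ z : T, (z : Pt d) ≠ 0 := fun z h => by
    have := hT1 z
    rw [h, val_zero] at this
    exact zero_ne_one this
  choose a ha haN using fun z : T => N₁.exists_support_functional (hT0 z)
  have hnet : ∀ x : Pt d, x ≠ 0 → ∃ f : T, (1 - κ) * N₁.val x ≤ |a f x| := by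
    intro x hx
    have hx1 := N₁.val_inv_smul_self hx
    have hpos := N₁.val_pos hx
    obtain ⟨z, hz, hxz⟩ := Set.mem_iUnion₂.1 (hTcov hx1)
    have hxz : N₁.val ((N₁.val x)⁻¹ • x - z) < κ := hxz
    refine ⟨⟨z, hz⟩, ?_⟩
    have h1 := (abs_le.1 (haN ⟨z, hz⟩ ((N₁.val x)⁻¹ • x - z))).1
    rw [map_sub, ha ⟨z, hz⟩, hT1 ⟨z, hz⟩, map_smul, smul_eq_mul] at h1
    have h2 : 1 - κ ≤ (N₁.val x)⁻¹ * a ⟨z, hz⟩ x := by linarith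
    rw [inv_mul_eq_div, le_div_iff₀ hpos] at h2
    exact h2.trans (le_abs_self _)
  have ha0 : ∀ x, (∀ f, a f x = 0) → x = 0 := by
    intro x h
    by_contra hx
    obtain ⟨f, hf⟩ := hnet x hx
    rw [h f, abs_zero] at hf
    nlinarith [N₁.val_pos hx]
  refine ⟨T, inferInstance, a, κ, hκ, fun μ hμ => ?_⟩
  set M := polyhedral a ha0 μ fun f => one_pos.trans (hμ f).1 with hM
  have hMN₁ : ∀ x, M.val x ≤ N₁.val x := fun x => by
    refine polyhedral_le (N₁.val_nonneg x) fun f => (haN f x).trans ?_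
    exact le_mul_of_one_le_right (N₁.val_nonneg x) (hμ f).1.le
  have hN₁M : ∀ x, N₁.val x ≤ (1 + 4 * κ) * M.val x := fun x => by
    by_cases hx : x = 0
    · simp [hx, val_zero]
    obtain ⟨f, hf⟩ := hnet x hx
    have h1 : |a f x| ≤ μ f * M.val x := le_polyhedral x f
    have h2 : μ f * M.val x ≤ (1 + κ) * M.val x :=
      mul_le_mul_of_nonneg_right (hμ f).2.le (M.val_nonneg x)
    have h3 : (1 + κ) * M.val x ≤ (1 - κ) * (1 + 4 * κ) * M.val x :=
      mul_le_mul_of_nonneg_right (by nlinarith) (M.val_nonneg x)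
    have h4 : (1 - κ) * N₁.val x ≤ (1 - κ) * ((1 + 4 * κ) * M.val x) := by linarith
    exact le_of_mul_le_mul_left h4 (by linarith)
  -- A unit vector `u` of `M` on the facet of `f` satisfies `N₁ u ≤ 1 + 4κ` and `N₁ (u + f) ≥ a f (u
  -- + f) ≥ 2`, up to the sign of `u`; uniform convexity then forces `u` close to `f`.
  have hfacet : ∀ f u, M.val u = 1 → |a f u| = μ f → ‖u - f‖ < η / 2 ∨ ‖u + f‖ < η / 2 := by
    have main : ∀ (f : T) (u : Pt d), M.val u = 1 → 1 ≤ a f u → ‖u - f‖ < η / 2 := by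
      intro f u hu hf
      have h1 := N.hilbertSum_parallelogram e u f
      rw [← hN₁, hT1 f] at h1
      have h2 : 2 ≤ N₁.val (u + f) := by
        refine le_trans ?_ ((le_abs_self _).trans (haN f _))
        rw [map_add, ha f, hT1 f]
        linarith
      have h3 := hN₁M u
      rw [hu, mul_one] at h3
      have h4 : N₁.val u ^ 2 ≤ (1 + 4 * κ) ^ 2 := pow_le_pow_left₀ (N₁.val_nonneg u) h3 2
      have h5 : (e * ‖u - f‖) ^ 2 ≤ 32 * κ := by nlinarith
      have h6 : (e * ‖u - f‖) ^ 2 < (e * (η / 2)) ^ 2 := by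
        have : 0 < e ^ 2 * η ^ 2 := by positivity
        nlinarith
      have h7 := lt_of_pow_lt_pow_left₀ 2 (by positivity) h6
      exact lt_of_mul_lt_mul_left h7 he0.le
    intro f u hu hf
    have hμf := (hμ f).1
    rcases le_total 0 (a f u) with h | h
    · rw [abs_of_nonneg h] at hf
      exact Or.inl (main f u hu (by linarith))
    · rw [abs_of_nonpos h] at hf
      right
      have := main f (-u) (by rw [val_neg, hu]) (by rw [map_neg]; linarith)
      rwa [← norm_neg, neg_sub, sub_neg_eq_add, add_comm] at this
  refine ⟨M, ?_, fun u hu => exists_eq_of_polyhedral_eq_one hu, ?_⟩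
  · rw [dist_comm]
    refine (dist_le_of_val_le N M (κ := e * R + 4 * κ) (by positivity) hNR hR.le (fun x => ?_)
      fun x => ?_).trans_lt ?_
    · refine (hMN₁ x).trans ((hN₁N x).trans ?_)
      exact mul_le_mul_of_nonneg_right (by linarith) (N.val_nonneg x)
    · refine (N.le_hilbertSum e x).trans ((hN₁M x).trans ?_)
      refine mul_le_mul_of_nonneg_right ?_ (M.val_nonneg x)
      have : 0 ≤ e * R := by positivity
      linarith
    · have h1 : e * R * R = δ / 4 := by rw [he]; field_simp
      have h2 : κ * (16 * R) ≤ δ := by rwa [le_div_iff₀ (by positivity)] at hκ2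
      nlinarith
  · intro f u v hu hv hfu hfv
    rcases hfacet f u hu hfu with h1 | h1 <;> rcases hfacet f v hv hfv with h2 | h2
    · left
      have := norm_sub_le (u - f) (v - f)
      rw [sub_sub_sub_cancel_right] at this
      linarith
    · right
      have := norm_add_le (u - f) (v + f)
      rw [show u - f + (v + f) = u + v by abel] at this
      linarith
    · right
      have := norm_add_le (u + f) (v - f)
      rw [show u + f + (v - f) = u + v by abel] at this
      linarith
    · left
      have := norm_sub_le (u + f) (v + f)
      rw [show u + f - (v + f) = u - v by abel] at this
      linarith

end DNorm

/-! ### The meagre set of exceptional norms -/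

namespace DNorm

variable {d : ℕ}

/-- The linear combinations of `y` whose coefficients are the values at `s` of given polynomials. -/
noncomputable def polyComb {m k t : ℕ} (c : Fin t → Fin k → MvPolynomial (Fin m) ℤ)
    (p : (Fin m → ℝ) × (Fin k → Pt d)) (i : Fin t) : Pt d :=
  ∑ l, MvPolynomial.aeval p.1 (c i l) • p.2 l

theorem contDiff_aeval_fst {m : ℕ} {E : Type*} [NormedAddCommGroup E] [NormedSpace ℝ E]
    (q : MvPolynomial (Fin m) ℤ) :
    ContDiff ℝ 1 fun p : (Fin m → ℝ) × E => MvPolynomial.aeval p.1 q := by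
  induction q using MvPolynomial.induction_on with
  | C a => simp only [MvPolynomial.aeval_C]; exact contDiff_const
  | add p q hp hq => simp only [map_add]; exact hp.add hq
  | mul_X p i hp =>
    simp only [map_mul, MvPolynomial.aeval_X]
    exact hp.mul (by fun_prop)

theorem contDiff_polyComb {m k t : ℕ} (c : Fin t → Fin k → MvPolynomial (Fin m) ℤ) (i : Fin t) :
    ContDiff ℝ 1 fun p : (Fin m → ℝ) × (Fin k → Pt d) => polyComb c p i := by
  unfold polyComb
  refine ContDiff.sum fun l _ => (contDiff_aeval_fst _).smul ?_
  exact (contDiff_apply ℝ (Pt d) l).comp contDiff_snd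

/-- The norms for which the vectors `polyComb c p i` are unit vectors, well separated up to sign,
for some `p` of size at most `j`. -/
def manyUnitVectors {m k t : ℕ} (c : Fin t → Fin k → MvPolynomial (Fin m) ℤ) (j : ℕ) :
    Set (DNorm d) :=
  {N | ∃ p : (Fin m → ℝ) × (Fin k → Pt d), ‖p‖ ≤ j ∧ (∀ i, N.val (polyComb c p i) = 1) ∧
    ∀ i i', i ≠ i' → 1 / ((j : ℝ) + 1) ≤ ‖polyComb c p i - polyComb c p i'‖ ∧
      1 / ((j : ℝ) + 1) ≤ ‖polyComb c p i + polyComb c p i'‖}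

/-- The parameters range over a compact ball, along which projection to the norms is a closed map.
The fixed separation `1 / (j + 1)` keeps the condition closed. -/
theorem isClosed_manyUnitVectors {m k t : ℕ} (c : Fin t → Fin k → MvPolynomial (Fin m) ℤ)
    (j : ℕ) : IsClosed (manyUnitVectors (d := d) c j) := by
  have hK : IsCompact (Metric.closedBall (0 : (Fin m → ℝ) × (Fin k → Pt d)) j) :=
    isCompact_closedBall _ _
  have := isCompact_iff_compactSpace.1 hK
  have hcont : ∀ i, Continuous fun q : DNorm d × Metric.closedBall
      (0 : (Fin m → ℝ) × (Fin k → Pt d)) (j : ℝ) => polyComb c q.2.1 i := fun i =>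
    (contDiff_polyComb c i).continuous.comp (continuous_subtype_val.comp continuous_snd)
  have hcl : IsClosed ((⋂ i, {q : DNorm d × Metric.closedBall
      (0 : (Fin m → ℝ) × (Fin k → Pt d)) (j : ℝ) | q.1.val (polyComb c q.2.1 i) = 1}) ∩
      ⋂ i, ⋂ i', ⋂ _ : i ≠ i', ({q | 1 / ((j : ℝ) + 1) ≤
        ‖polyComb c q.2.1 i - polyComb c q.2.1 i'‖} ∩ {q | 1 / ((j : ℝ) + 1) ≤
        ‖polyComb c q.2.1 i + polyComb c q.2.1 i'‖})) := by
    refine IsClosed.inter (isClosed_iInter fun i => isClosed_eq ?_ continuous_const) ?_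
    · exact continuous_val_uncurry.comp (continuous_fst.prodMk (hcont i))
    · refine isClosed_iInter fun i => isClosed_iInter fun i' => isClosed_iInter fun _ =>
        IsClosed.inter (isClosed_le continuous_const ?_) (isClosed_le continuous_const ?_)
      · exact ((hcont i).sub (hcont i')).norm
      · exact ((hcont i).add (hcont i')).norm
  convert isClosedMap_fst_of_compactSpace _ hcl using 1
  ext N
  constructor
  · rintro ⟨p, hp, h1, h2⟩
    refine ⟨(N, ⟨p, by simpa using hp⟩), ⟨?_, ?_⟩, rfl⟩
    · exact Set.mem_iInter.2 h1
    · exact Set.mem_iInter.2 fun i => Set.mem_iInter.2 fun i' => Set.mem_iInter.2 fun h => h2 i i' h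
  · rintro ⟨⟨M, p⟩, ⟨h1, h2⟩, rfl⟩
    refine ⟨p.1, mem_closedBall_zero_iff.1 p.2, fun i => Set.mem_iInter.1 h1 i, fun i i' h => ?_⟩
    exact Set.mem_iInter.1 (Set.mem_iInter.1 (Set.mem_iInter.1 h2 i) i') h

/-- A family of `t` functions of `D < t` real parameters cannot prescribe `t` coordinates of a
vector: the vectors with such coordinates form a set of small dimension. -/
theorem dimH_setOf_comp_eq_le {E ι : Type*} [NormedAddCommGroup E] [NormedSpace ℝ E]
    [FiniteDimensional ℝ E] [Fintype ι] {t : ℕ} (φ : Fin t → ι) (hφ : Function.Injective φ)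
    (G : E → Fin t → ℝ) (hG : ContDiff ℝ 1 G) (ht : Module.finrank ℝ E + 1 = t) :
    dimH {μ : ι → ℝ | ∃ p, ∀ i, μ (φ i) = G p i} ≤ ((Fintype.card ι - 1 : ℕ) : ENNReal) := by
  classical
  -- The coordinates outside the range of `φ` are free, so the set is covered by a smooth image of a
  -- space of dimension `(t - 1) + (card ι - t)`.
  let H : E × ({f // f ∉ Set.range φ} → ℝ) → ι → ℝ := fun q f =>
    if h : f ∈ Set.range φ then G q.1 h.choose else q.2 ⟨f, h⟩
  have hH : ContDiff ℝ 1 H := by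
    rw [contDiff_pi]
    intro f
    by_cases h : f ∈ Set.range φ
    · simp only [H, h, dite_true]
      exact ((contDiff_apply ℝ ℝ _).comp hG).comp contDiff_fst
    · simp only [H, h, dite_false]
      exact (contDiff_apply ℝ ℝ _).comp contDiff_snd
  have hsub : {μ : ι → ℝ | ∃ p, ∀ i, μ (φ i) = G p i} ⊆ Set.range H := by
    rintro μ ⟨p, hp⟩
    refine ⟨(p, fun f => μ f), funext fun f => ?_⟩
    by_cases h : f ∈ Set.range φ
    · simp only [H, h, dite_true]
      rw [← hp, h.choose_spec]
    · simp only [H, h, dite_false]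
  refine (dimH_mono hsub).trans (hH.dimH_range_le.trans ?_)
  have hcard : Fintype.card {f // f ∉ Set.range φ} = Fintype.card ι - t := by
    rw [Fintype.card_subtype_compl]
    congr 1
    rw [Set.card_range_of_injective hφ, Fintype.card_fin]
  have htι : t ≤ Fintype.card ι := by simpa using Fintype.card_le_of_injective φ hφ
  rw [Module.finrank_prod, Module.finrank_fintype_fun_eq_card, hcard]
  exact_mod_cast (by omega)

/-- If the closed set contained a ball, it would contain polyhedral norms with generic heights `μ`.
Their `t` separated unit vectors occupy `t` different facets, so `t` entries of `μ` would depend on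
only `d * k + m` parameters. -/
theorem isNowhereDense_manyUnitVectors {m k t : ℕ}
    (c : Fin t → Fin k → MvPolynomial (Fin m) ℤ) (ht : d * k + m + 1 = t) (j : ℕ) :
    IsNowhereDense (manyUnitVectors (d := d) c j) := by
  rw [(isClosed_manyUnitVectors c j).isNowhereDense_iff, Set.eq_empty_iff_forall_notMem]
  intro N hN
  obtain ⟨δ, hδ, hball⟩ := Metric.mem_nhds_iff.1 (mem_interior_iff_mem_nhds.1 hN)
  obtain ⟨ι, _, a, κ, hκ, hM⟩ := N.exists_polyhedral_approx hδ
    (η := 1 / ((j : ℝ) + 1)) (by positivity)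
  let G : Set.range (fun φ : Fin t ↪ ι => (φ : Fin t → ι)) × (Fin t → Bool) →
      (Fin m → ℝ) × (Fin k → Pt d) → Fin t → ℝ :=
    fun w p i => (if w.2 i then 1 else -1) * a (w.1.1 i) (polyComb c p i)
  have hG : ∀ w, ContDiff ℝ 1 (G w) := fun w => by
    rw [contDiff_pi]
    intro i
    refine contDiff_const.mul ?_
    exact (a (w.1.1 i)).toContinuousLinearMap.contDiff.comp (contDiff_polyComb c i)
  -- One piece for each of the finitely many choices of facets and of signs of the functionals.
  let bad : Set (ι → ℝ) := ⋃ w, {μ | ∃ p, ∀ i, μ (w.1.1 i) = G w p i}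
  have hdim : dimH bad ≤ ((Fintype.card ι - 1 : ℕ) : ENNReal) := by
    have hc : Countable (Set.range (fun φ : Fin t ↪ ι => (φ : Fin t → ι)) × (Fin t → Bool)) :=
      Finite.to_countable
    rw [dimH_iUnion]
    refine iSup_le fun w => ?_
    obtain ⟨φ, hφ⟩ := w.1.2
    refine dimH_setOf_comp_eq_le w.1.1 (hφ ▸ φ.injective) (G w) (hG w) ?_
    rw [← ht]
    simp [Module.finrank_pi_fintype]
    ring
  have hex : ∃ μ : ι → ℝ, (∀ f, 1 < μ f ∧ μ f < 1 + κ) ∧ μ ∉ bad := by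
    -- With no facets `card ι - 1` truncates to `0` and the dimension bound is not strict; but then
    -- `bad` is empty, since `t` is positive.
    by_cases hι : Fintype.card ι = 0
    · refine ⟨fun _ => 1 + κ / 2, fun f => ⟨by linarith, by linarith⟩, fun hmem => ?_⟩
      obtain ⟨w, -⟩ := Set.mem_iUnion.1 hmem
      exact (Fintype.card_eq_zero_iff.1 hι).false (w.1.1 ⟨0, by omega⟩)
    · have hd : Dense badᶜ := by
        refine dense_compl_of_dimH_lt_finrank (hdim.trans_lt ?_)
        rw [Module.finrank_fintype_fun_eq_card]
        exact_mod_cast (by omega)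
      have ho : IsOpen (Set.univ.pi fun _ : ι => Set.Ioo (1 : ℝ) (1 + κ)) :=
        isOpen_set_pi Set.finite_univ fun _ _ => isOpen_Ioo
      obtain ⟨μ, hμ, hμ'⟩ := hd.inter_open_nonempty _ ho
        ⟨fun _ => 1 + κ / 2, fun f _ => ⟨by linarith, by linarith⟩⟩
      exact ⟨μ, fun f => hμ f trivial, hμ'⟩
  obtain ⟨μ, hμ, hbad⟩ := hex
  obtain ⟨M, hMN, hunit, hfacet⟩ := hM μ hμ
  obtain ⟨p, -, h1, h2⟩ := hball hMN
  choose φ hφ using fun i => hunit _ (h1 i)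
  have hinj : Function.Injective φ := by
    intro i i' h
    by_contra hne
    obtain ⟨h3, h4⟩ := h2 i i' hne
    rcases hfacet (φ i) _ _ (h1 i) (h1 i') (hφ i) (h ▸ hφ i') with h5 | h5 <;> linarith
  refine hbad (Set.mem_iUnion.2 ⟨(⟨φ, ⟨⟨φ, hinj⟩, rfl⟩⟩,
    fun i => decide (0 ≤ a (φ i) (polyComb c p i))), p, fun i => ?_⟩)
  simp only [G, decide_eq_true_eq, ← hφ i]
  split_ifs with h
  · rw [abs_of_nonneg h, one_mul]
  · rw [abs_of_neg (not_le.1 h), neg_one_mul]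

/-- The exceptional norms: those with more unit vectors in a finite-dimensional space over a
finitely generated field than their degrees of freedom allow. -/
def exceptional (d : ℕ) : Set (DNorm d) :=
  ⋃ (m : ℕ) (k : ℕ) (c : Fin (d * k + m + 1) → Fin k → MvPolynomial (Fin m) ℤ) (j : ℕ),
    manyUnitVectors c j

instance instCountableMvPolynomialInt (m : ℕ) : Countable (MvPolynomial (Fin m) ℤ) := by
  refine Function.Injective.countable
    (f := fun p : MvPolynomial (Fin m) ℤ => (AddMonoidAlgebra.coeff p : (Fin m →₀ ℕ) →₀ ℤ)) ?_
  rintro ⟨p⟩ ⟨q⟩ h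
  exact congrArg _ h

theorem isMeagre_exceptional (d : ℕ) : IsMeagre (exceptional d) :=
  isMeagre_iUnion fun _ => isMeagre_iUnion fun _ => isMeagre_iUnion fun c => isMeagre_iUnion
    fun j => (isNowhereDense_manyUnitVectors c rfl j).isMeagre

end DNorm

/-! ### Few unit vectors in a space over a finitely generated field -/

theorem Subfield.exists_common_denominator {K ι : Type*} [Field K] [Fintype ι] {s : Set K}
    (x : ι → K) (hx : ∀ i, x i ∈ Subfield.closure s) :
    ∃ q ∈ Subring.closure s, q ≠ 0 ∧ ∀ i, q * x i ∈ Subring.closure s := by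
  classical
  choose y hy z hz hyz using fun i => Subfield.mem_closure_iff.1 (hx i)
  let w : ι → K := fun i => if z i = 0 then 1 else z i
  have hw : ∀ i, w i ∈ Subring.closure s := fun i => by
    simp only [w]
    split_ifs
    · exact one_mem _
    · exact hz i
  have hw0 : ∀ i, w i ≠ 0 := fun i => by
    simp only [w]
    split_ifs with h
    · exact one_ne_zero
    · exact h
  have hwx : ∀ i, w i * x i ∈ Subring.closure s := fun i => by
    simp only [w]
    split_ifs with h
    · rw [← hyz i, h, div_zero, mul_zero]
      exact zero_mem _
    · rw [← hyz i, mul_div_cancel₀ _ h]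
      exact hy i
  refine ⟨∏ i, w i, prod_mem fun i _ => hw i, Finset.prod_ne_zero_iff.2 fun i _ => hw0 i,
    fun i => ?_⟩
  rw [← Finset.mul_prod_erase _ _ (Finset.mem_univ i), mul_right_comm]
  exact mul_mem (hwx i) (prod_mem fun i _ => hw i)

theorem Subring.exists_aeval_eq_of_mem_closure_range {K ι : Type*} [CommRing K] {r : ι → K}
    {x : K} (hx : x ∈ Subring.closure (Set.range r)) :
    ∃ p : MvPolynomial ι ℤ, MvPolynomial.aeval r p = x := by
  have h : x ∈ Algebra.adjoin ℤ (Set.range r) := by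
    rw [Algebra.adjoin_int]
    exact hx
  rw [Algebra.adjoin_range_eq_range_aeval] at h
  exact h

namespace DNorm

variable {d : ℕ}

/-- A norm that is not exceptional has at most `d k + m` unit vectors, up to sign, in a space of
dimension `k` over a field generated by `m` real numbers. -/
theorem card_unitVectors_le {N : DNorm d} (hN : N ∉ exceptional d) {m : ℕ} (r : Fin m → ℝ)
    (W : Submodule (Subfield.closure (Set.range r)) (Pt d))
    [Module.Finite (Subfield.closure (Set.range r)) W]
    (U : Finset (Pt d)) (hUW : ∀ u ∈ U, u ∈ W) (hU1 : ∀ u ∈ U, N.val u = 1)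
    (hU : ∀ u ∈ U, -u ∉ U) :
    U.card ≤ d * Module.finrank (Subfield.closure (Set.range r)) W + m := by
  set k := Module.finrank (Subfield.closure (Set.range r)) W with hk
  by_contra! hlt
  have hlt : d * k + m + 1 ≤ U.card := hlt
  let u : Fin (d * k + m + 1) → Pt d := fun i => U.equivFin.symm (Fin.castLE hlt i)
  have hu : ∀ i, u i ∈ U := fun i => (U.equivFin.symm (Fin.castLE hlt i)).2
  have huinj : Function.Injective u := fun i i' h =>
    Fin.castLE_injective hlt (U.equivFin.symm.injective (Subtype.ext h))
  let b := Module.finBasis (Subfield.closure (Set.range r)) W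
  obtain ⟨q, hq, hq0, hqc⟩ := Subfield.exists_common_denominator
    (fun w : Fin (d * k + m + 1) × Fin k => ((b.repr ⟨u w.1, hUW _ (hu w.1)⟩ w.2 :
      Subfield.closure (Set.range r)) : ℝ)) (fun w => Subtype.property _)
  choose c hc using fun w => Subring.exists_aeval_eq_of_mem_closure_range (hqc w)
  let c' : Fin (d * k + m + 1) → Fin k → MvPolynomial (Fin m) ℤ := fun i l => c (i, l)
  -- The common denominator `q` is absorbed into the basis, which leaves integer polynomials in `r`
  -- as coefficients.
  let p : (Fin m → ℝ) × (Fin k → Pt d) := (r, fun l => q⁻¹ • (b l : Pt d))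
  have hcomb : ∀ i, polyComb c' p i = u i := by
    intro i
    have h1 := b.sum_repr ⟨u i, hUW _ (hu i)⟩
    have h2 := congrArg (Subtype.val) h1
    simp only [AddSubmonoidClass.coe_finsetSum, Submodule.coe_smul] at h2
    rw [← h2]
    refine Finset.sum_congr rfl fun l _ => ?_
    simp only [c', p, hc, smul_smul]
    rw [mul_right_comm, mul_inv_cancel₀ hq0, one_mul]
    rfl
  have hj : ∀ᶠ j : ℕ in atTop, ‖p‖ ≤ j ∧ ∀ i i', i ≠ i' →
      1 / ((j : ℝ) + 1) ≤ ‖u i - u i'‖ ∧ 1 / ((j : ℝ) + 1) ≤ ‖u i + u i'‖ := by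
    have hlim := tendsto_one_div_add_atTop_nhds_zero_nat (𝕜 := ℝ)
    refine (eventually_ge_atTop ⌈‖p‖⌉₊).mono (fun j hj => Nat.ceil_le.1 hj) |>.and ?_
    refine eventually_all.2 fun i => eventually_all.2 fun i' => ?_
    by_cases h : i = i'
    · exact Eventually.of_forall fun _ hne => absurd h hne
    have h1 : 0 < ‖u i - u i'‖ := norm_pos_iff.2 (sub_ne_zero.2 (huinj.ne h))
    have h2 : 0 < ‖u i + u i'‖ := by
      refine norm_pos_iff.2 fun h0 => hU _ (hu i') ?_
      rw [← eq_neg_of_add_eq_zero_left h0]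
      exact hu i
    filter_upwards [hlim.eventually (eventually_le_nhds h1),
      hlim.eventually (eventually_le_nhds h2)] with j h3 h4 _
    exact ⟨h3, h4⟩
  obtain ⟨j, hj1, hj2⟩ := hj.exists
  refine hN (Set.mem_iUnion.2 ⟨m, Set.mem_iUnion.2 ⟨k, Set.mem_iUnion.2 ⟨c',
    Set.mem_iUnion.2 ⟨j, p, hj1, fun i => ?_, fun i i' h => ?_⟩⟩⟩⟩)
  · rw [hcomb]; exact hU1 _ (hu i)
  · rw [hcomb, hcomb]; exact hj2 i i' h

end DNorm

/-! ### Ungar's theorem: the combinatorial core -/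

namespace Ungar

variable {ι : Type*}

/-- Whenever two points are strictly ordered by `g k`, they are ordered in the same way by the
neighbouring `h k` and `h (k + 1)`. -/
def Compatible (h g : ℕ → ι → ℝ) : Prop :=
  ∀ k i j, g k i < g k j → h k i < h k j ∧ h (k + 1) i < h (k + 1) j

theorem Compatible.neg {h g : ℕ → ι → ℝ} (H : Compatible h g) : Compatible (-h) (-g) := by
  intro k i j hij
  simp only [Pi.neg_apply, neg_lt_neg_iff] at hij ⊢
  exact H k j i hij

/-- In one move `z` can change its order only with points tied with it, and `S` contains at most one
such point. -/
theorem card_filter_lt_le_add_one {f f' e : ι → ℝ}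
    (H : ∀ i j, e i < e j → f i < f j ∧ f' i < f' j) (S : Finset ι) (hS : Set.InjOn e S) (z : ι) :
    (S.filter fun b => f z < f b).card ≤ (S.filter fun b => f' z < f' b).card + 1 := by
  classical
  have hsub : (S.filter fun b => f z < f b) ⊆
      (S.filter fun b => f' z < f' b) ∪ S.filter fun b => e b = e z := by
    intro b hb
    simp only [Finset.mem_filter, Finset.mem_union] at hb ⊢
    rcases lt_trichotomy (e b) (e z) with h | h | h
    · exact absurd (H _ _ h).1 hb.2.not_gt
    · exact Or.inr ⟨hb.1, h⟩
    · exact Or.inl ⟨hb.1, (H _ _ h).2⟩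
  refine (Finset.card_le_card hsub).trans ((Finset.card_union_le _ _).trans ?_)
  refine Nat.add_le_add_left (Finset.card_le_one.2 fun a ha b hb => ?_) _
  simp only [Finset.mem_filter] at ha hb
  exact hS ha.1 hb.1 (ha.2.trans hb.2.symm)

theorem Compatible.card_filter_lt_le_forward {h g : ℕ → ι → ℝ} (H : Compatible h g) (S : Finset ι)
    (z : ι) (k n : ℕ) (hS : ∀ l, k ≤ l → l < k + n → Set.InjOn (g l) S) :
    (S.filter fun b => h k z < h k b).card ≤
      (S.filter fun b => h (k + n) z < h (k + n) b).card + n := by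
  induction n with
  | zero => simp
  | succ n ih =>
    have h1 := ih fun l hl hl' => hS l hl (by omega)
    have h2 := card_filter_lt_le_add_one (H (k + n)) S (hS _ (by omega) (by omega)) z
    rw [show k + (n + 1) = k + n + 1 from rfl]
    omega

theorem Compatible.card_filter_lt_le_backward {h g : ℕ → ι → ℝ} (H : Compatible h g)
    (S : Finset ι) (z : ι) (k n : ℕ) (hS : ∀ l, k ≤ l → l < k + n → Set.InjOn (g l) S) :
    (S.filter fun b => h (k + n) z < h (k + n) b).card ≤
      (S.filter fun b => h k z < h k b).card + n := by
  induction n with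
  | zero => simp
  | succ n ih =>
    have h1 := ih fun l hl hl' => hS l hl (by omega)
    have h2 := card_filter_lt_le_add_one (fun i j hij => (H (k + n) i j hij).symm) S
      (hS _ (by omega) (by omega)) z
    rw [show k + (n + 1) = k + n + 1 from rfl]
    omega

theorem Compatible.card_le_forward {h g : ℕ → ι → ℝ} (H : Compatible h g) (S : Finset ι)
    (z : ι) (k n : ℕ) (hS : ∀ l, k ≤ l → l < k + n → Set.InjOn (g l) S)
    (h1 : ∀ b ∈ S, h k z < h k b) (h2 : ∀ b ∈ S, h (k + n) b ≤ h (k + n) z) : S.card ≤ n := by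
  have := H.card_filter_lt_le_forward S z k n hS
  rwa [Finset.filter_true_of_mem h1, Finset.filter_false_of_mem fun b hb => (h2 b hb).not_gt,
    Finset.card_empty, zero_add] at this

theorem Compatible.card_le_backward {h g : ℕ → ι → ℝ} (H : Compatible h g) (S : Finset ι)
    (z : ι) (k n : ℕ) (hS : ∀ l, k ≤ l → l < k + n → Set.InjOn (g l) S)
    (h1 : ∀ b ∈ S, h (k + n) z < h (k + n) b) (h2 : ∀ b ∈ S, h k b ≤ h k z) : S.card ≤ n := by
  have := H.card_filter_lt_le_backward S z k n hS
  rwa [Finset.filter_true_of_mem h1, Finset.filter_false_of_mem fun b hb => (h2 b hb).not_gt,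
    Finset.card_empty, zero_add] at this

variable [Fintype ι]

/-- The `N` indices with the smallest values of `f`. -/
noncomputable def lowest (N : ℕ) (f : ι → ℝ) : Finset ι := {i | Finset.card {j | f j < f i} < N}

theorem mem_lowest {N : ℕ} {f : ι → ℝ} {i : ι} :
    i ∈ lowest N f ↔ Finset.card {j | f j < f i} < N := by simp [lowest]

theorem lt_of_mem_lowest {N : ℕ} {f : ι → ℝ} {i j : ι} (hi : i ∈ lowest N f)
    (hj : j ∉ lowest N f) : f i < f j := by
  by_contra! h
  rw [mem_lowest] at hi hj
  refine hj (lt_of_le_of_lt (Finset.card_le_card fun l hl => ?_) hi)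
  simp only [Finset.mem_filter_univ] at hl ⊢
  exact hl.trans_le h

theorem card_lowest {N : ℕ} {f : ι → ℝ} (hf : Function.Injective f) (hN : N ≤ Fintype.card ι) :
    (lowest N f).card = N := by
  let rank : ι → Fin (Fintype.card ι) := fun i => ⟨Finset.card {j | f j < f i}, by
    refine Finset.card_lt_univ_of_notMem (x := i) ?_
    simp⟩
  have hmono : ∀ i j, f i < f j → rank i < rank j := by
    intro i j hij
    refine Finset.card_lt_card (Finset.ssubset_iff_of_subset ?_ |>.2 ⟨i, ?_, ?_⟩)
    · intro l hl
      simp only [Finset.mem_filter_univ] at hl ⊢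
      exact hl.trans hij
    · simpa using hij
    · simp
  have hinj : Function.Injective rank := by
    intro i j h
    by_contra hne
    rcases lt_or_gt_of_ne (hf.ne hne) with h1 | h1
    · exact (hmono _ _ h1).ne h
    · exact (hmono _ _ h1).ne' h
  have hbij : Function.Bijective rank :=
    (Fintype.bijective_iff_injective_and_card _).2 ⟨hinj, by simp⟩
  have h1 : (lowest N f).map ⟨rank, hinj⟩ = Finset.univ.filter fun a : Fin (Fintype.card ι) => (a : ℕ) < N := by
    ext a
    obtain ⟨i, rfl⟩ := hbij.2 a
    simp only [Finset.mem_map, Function.Embedding.coeFn_mk, Finset.mem_filter_univ, rank]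
    constructor
    · rintro ⟨j, hj, hji⟩
      rw [← hinj hji]
      exact mem_lowest.1 hj
    · exact fun h => ⟨i, mem_lowest.2 h, rfl⟩
  rw [← Finset.card_map ⟨rank, hinj⟩, h1, Fin.card_filter_val_lt, min_eq_right hN]

theorem disjoint_lowest_neg {N : ℕ} {f : ι → ℝ} (hf : Function.Injective f)
    (hN : 2 * N ≤ Fintype.card ι) : Disjoint (lowest N f) (lowest N (-f)) := by
  classical
  rw [Finset.disjoint_left]
  intro i h1 h2
  rw [mem_lowest] at h1 h2
  simp only [Pi.neg_apply, neg_lt_neg_iff] at h2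
  have h3 : (Finset.univ : Finset ι) ⊆
      insert i (Finset.filter (fun j => f j < f i) Finset.univ ∪
        Finset.filter (fun j => f i < f j) Finset.univ) := by
    intro j _
    simp only [Finset.mem_insert, Finset.mem_union, Finset.mem_filter_univ]
    rcases lt_trichotomy (f j) (f i) with h | h | h
    · exact Or.inr (Or.inl h)
    · exact Or.inl (hf h)
    · exact Or.inr (Or.inr h)
  have h4 := (Finset.card_le_card h3).trans (Finset.card_insert_le _ _)
  have h5 := Finset.card_union_le (Finset.filter (fun j => f j < f i) Finset.univ)
    (Finset.filter (fun j => f i < f j) Finset.univ)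
  rw [Finset.card_univ] at h4
  omega

/-- The setting of Ungar's argument: a cyclic sequence of linear orders `h k`, where the passage
from `h k` to `h (k + 1)` only affects pairs of points on which `g k` agrees. -/
structure CyclicOrders (h g : ℕ → ι → ℝ) (t : ℕ) : Prop where
  inj : ∀ k, Function.Injective (h k)
  compat : Compatible h g
  tie : ∀ k l i j, i ≠ j → g k i = g k j → g l i = g l j → k < l → k + t ≤ l
  period : ∀ k, h (k + t) = -h k
  pos : 0 < t
  nonconst : ∀ k (v : ℝ), ∃ i, g k i ≠ v

section crossing

variable [DecidableEq ι] (N : ℕ) (h : ℕ → ι → ℝ)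

/-- The number of points that cross the barrier after the `N` lowest ones at time `k`. -/
noncomputable def crossing (k : ℕ) : ℕ := (lowest N (h (k + 1)) \ lowest N (h k)).card

variable {N h} {g : ℕ → ι → ℝ} {t : ℕ}

theorem CyclicOrders.card_sdiff (H : CyclicOrders h g t) (hN : N ≤ Fintype.card ι) (k : ℕ) :
    (lowest N (h k) \ lowest N (h (k + 1))).card = crossing N h k := by
  refine Finset.card_sdiff_comm ?_
  rw [card_lowest (H.inj _) hN, card_lowest (H.inj _) hN]

/-- A point leaving the lowest `N` and a point entering them exchange their order, so `g k` agrees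
on them; all crossing points thus share one value. -/
theorem CyclicOrders.exists_value (H : CyclicOrders h g t) (hN : N ≤ Fintype.card ι) {k : ℕ} (hk : 0 < crossing N h k) :
    ∃ v, (∀ i ∈ lowest N (h k) \ lowest N (h (k + 1)), g k i = v) ∧
      ∀ i ∈ lowest N (h (k + 1)) \ lowest N (h k), g k i = v := by
  have key : ∀ a ∈ lowest N (h k) \ lowest N (h (k + 1)),
      ∀ b ∈ lowest N (h (k + 1)) \ lowest N (h k), g k a = g k b := by
    intro a ha b hb
    rw [Finset.mem_sdiff] at ha hb
    have h1 := lt_of_mem_lowest ha.1 hb.2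
    have h2 := lt_of_mem_lowest hb.1 ha.2
    rcases lt_trichotomy (g k a) (g k b) with h3 | h3 | h3
    · exact absurd (H.compat _ _ _ h3).2 h2.not_gt
    · exact h3
    · exact absurd (H.compat _ _ _ h3).1 h1.not_gt
  obtain ⟨b, hb⟩ := Finset.card_pos.1 hk
  obtain ⟨a, ha⟩ := Finset.card_pos.1 (hk.trans_eq (H.card_sdiff hN k).symm)
  exact ⟨g k a, fun i hi => (key i hi b hb).trans (key a ha b hb).symm,
    fun i hi => (key a ha i hi).symm⟩

theorem CyclicOrders.lowest_eq_of_crossing_eq_zero (H : CyclicOrders h g t) (hN : N ≤ Fintype.card ι) {k l : ℕ}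
    (hkl : k ≤ l) (h0 : ∀ j, k ≤ j → j < l → crossing N h j = 0) :
    lowest N (h l) = lowest N (h k) := by
  induction l, hkl using Nat.le_induction with
  | base => rfl
  | succ l hl ih =>
    rw [← ih fun j hj hj' => h0 j hj (by omega)]
    refine Finset.eq_of_subset_of_card_le ?_ ?_
    · exact Finset.sdiff_eq_empty_iff_subset.1 (Finset.card_eq_zero.1 (h0 l hl (by omega)))
    · rw [card_lowest (H.inj _) hN, card_lowest (H.inj _) hN]

/-- Otherwise the single move `k` would already exchange the `N` lowest and the `N` highest points.
These would all be tied, and so would everything between them, against `nonconst`. -/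
theorem CyclicOrders.exists_next (H : CyclicOrders h g t) (hN0 : 0 < N) (hN : 2 * N ≤ Fintype.card ι) {k : ℕ}
    (hk : 0 < crossing N h k) : ∃ l, k < l ∧ l < k + t ∧ 0 < crossing N h l := by
  by_contra! hno
  have hN' : N ≤ Fintype.card ι := by omega
  have ht := H.pos
  have hL : lowest N (-h k) = lowest N (h (k + 1)) := by
    rw [← H.period]
    refine H.lowest_eq_of_crossing_eq_zero hN' (by omega) fun j hj hj' => ?_
    have := hno j (by omega) hj'
    omega
  have hdisj := disjoint_lowest_neg (H.inj k) hN
  rw [hL] at hdisj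
  obtain ⟨v, hv1, hv2⟩ := H.exists_value hN' hk
  rw [Finset.sdiff_eq_self_of_disjoint hdisj] at hv1
  rw [Finset.sdiff_eq_self_of_disjoint hdisj.symm] at hv2
  obtain ⟨w, hw⟩ := H.nonconst k v
  obtain ⟨a, ha⟩ : (lowest N (h k)).Nonempty := by
    rw [← Finset.card_pos, card_lowest (H.inj _) hN']
    exact hN0
  obtain ⟨m, -, hm⟩ := Finset.exists_max_image Finset.univ (h k) ⟨w, Finset.mem_univ w⟩
  have hmv : g k m = v := by
    refine hv2 m ?_
    rw [← hL, mem_lowest]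
    convert hN0
    rw [Finset.card_eq_zero, Finset.filter_eq_empty_iff]
    intro j _
    simpa using hm j (Finset.mem_univ j)
  have hwL : w ∉ lowest N (h k) := fun hmem => hw (hv1 w hmem)
  have h1 := lt_of_mem_lowest ha hwL
  have h2 : v < g k w := by
    refine lt_of_le_of_ne ?_ hw.symm
    rw [← hv1 a ha]
    by_contra! h3
    exact absurd (H.compat _ _ _ h3).1 h1.not_gt
  rw [← hmv] at h2
  exact absurd (H.compat _ _ _ h2).1 (hm w (Finset.mem_univ w)).not_gt

/-- The heart of Ungar's argument. Move `k` leaves at least `D` tied points on each side of the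
barrier, and these separate again at a rate of at most one per move; before move `l` at least `D'`
points must likewise gather on each side. If `l - k < D + D'`, then at some time the two points next
to the barrier belong to both tied blocks, so the same pair is tied twice within less than `t`
moves. -/
theorem CyclicOrders.crossing_add_le (H : CyclicOrders h g t) (hN0 : 0 < N) (hN : 2 * N ≤ Fintype.card ι) {k l : ℕ}
    (hkl : k < l) (hlt : l < k + t) (hk : 0 < crossing N h k) (hl : 0 < crossing N h l)
    (h0 : ∀ j, k < j → j < l → crossing N h j = 0) :
    crossing N h k + crossing N h l + k ≤ l := by
  by_contra! hcon
  have hN' : N ≤ Fintype.card ι := by omega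
  obtain ⟨v, hv1, hv2⟩ := H.exists_value hN' hk
  obtain ⟨v', hv1', hv2'⟩ := H.exists_value hN' hl
  set D := crossing N h k with hD
  set D' := crossing N h l with hD'
  -- The critical time: fewer than `D` moves lie between `k + 1` and `m`, and fewer than `D'`
  -- between `m` and `l`.
  obtain ⟨m, hm⟩ : ∃ m, m = min l (k + D) := ⟨_, rfl⟩
  have hkm : k < m := by omega
  have hml : m ≤ l := by omega
  set L := lowest N (h m) with hLdef
  have hLeq : ∀ j, k < j → j ≤ l → lowest N (h j) = lowest N (h (k + 1)) := fun j hj hj' =>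
    H.lowest_eq_of_crossing_eq_zero hN' (by omega) fun i hi hi' => h0 i (by omega) (by omega)
  have hLk : lowest N (h (k + 1)) = L := (hLeq m hkm hml).symm
  have hLl : lowest N (h l) = L := by rw [hLeq l hkl le_rfl, hLk]
  rw [hLk] at hv1 hv2
  rw [hLl] at hv1' hv2'
  have hDout : (lowest N (h k) \ L).card = D := by rw [← hLk]; exact H.card_sdiff hN' k
  have hDin : (L \ lowest N (h k)).card = D := by rw [← hLk]; rfl
  have hDout' : (L \ lowest N (h (l + 1))).card = D' := by rw [← hLl]; exact H.card_sdiff hN' l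
  have hDin' : (lowest N (h (l + 1)) \ L).card = D' := by rw [← hLl]; rfl
  have hLne : L.Nonempty := by
    rw [← Finset.card_pos, card_lowest (H.inj _) hN']
    exact hN0
  have hLcne : Lᶜ.Nonempty := by
    rw [← Finset.card_pos, Finset.card_compl, card_lowest (H.inj _) hN']
    omega
  obtain ⟨x, hxL, hx⟩ := Finset.exists_max_image L (h m) hLne
  obtain ⟨y, hyL, hy⟩ := Finset.exists_min_image Lᶜ (h m) hLcne
  -- Points tied at time `k` are not tied again before `k + t`, hence not before `l`.
  have hinj : ∀ j, k < j → j < l → ∀ S : Finset ι, (∀ i ∈ S, g k i = v) → Set.InjOn (g j) S := by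
    intro j hj hj' S hS i hi i' hi' he
    by_contra hne
    have := H.tie k j i i' hne ((hS i hi).trans (hS i' hi').symm) he hj
    omega
  have hinj' : ∀ j, k < j → j < l → ∀ S : Finset ι, (∀ i ∈ S, g l i = v') →
      Set.InjOn (g j) S := by
    intro j hj hj' S hS i hi i' hi' he
    by_contra hne
    have := H.tie j l i i' hne he ((hS i hi).trans (hS i' hi').symm) hj'
    omega
  have ek : k + 1 + (m - (k + 1)) = m := by omega
  have el : m + (l - m) = l := by omega
  -- Otherwise `x` lies below `D` points of the block just after move `k`, yet is the highest point
  -- of `L` at time `m`; it can overtake only one of them per move.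
  have hxv : g k x = v := by
    by_contra hne
    have hlt : g k x < v := by
      obtain ⟨a, ha⟩ := Finset.card_pos.1 (hk.trans_eq hDout.symm)
      have h1 : h (k + 1) x < h (k + 1) a :=
        lt_of_mem_lowest (hLk ▸ hxL) (hLk ▸ (Finset.mem_sdiff.1 ha).2)
      refine lt_of_le_of_ne (le_of_not_gt fun h2 => ?_) hne
      exact absurd (H.compat k a x (by rwa [hv1 a ha])).2 h1.not_gt
    have hcard : D ≤ (L.filter fun i => g k i = v).card := by
      rw [← hDin]
      exact Finset.card_le_card fun i hi =>
        Finset.mem_filter.2 ⟨(Finset.mem_sdiff.1 hi).1, hv2 i hi⟩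
    have := H.compat.card_le_forward (L.filter fun i => g k i = v) x (k + 1) (m - (k + 1))
      (fun j hj hj' => hinj j (by omega) (by omega) _ fun i hi => (Finset.mem_filter.1 hi).2)
      (fun b hb => (H.compat k x b (by rwa [(Finset.mem_filter.1 hb).2])).2)
      (fun b hb => by rw [ek]; exact hx b (Finset.mem_filter.1 hb).1)
    omega
  have hyv : g k y = v := by
    by_contra hne
    have hlt : v < g k y := by
      obtain ⟨a, ha⟩ := Finset.card_pos.1 (hk.trans_eq hDin.symm)
      have h1 : h (k + 1) a < h (k + 1) y :=
        lt_of_mem_lowest (hLk ▸ (Finset.mem_sdiff.1 ha).1) (hLk ▸ Finset.mem_compl.1 hyL)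
      refine lt_of_le_of_ne (le_of_not_gt fun h2 => ?_) (Ne.symm hne)
      exact absurd (H.compat k y a (by rwa [hv2 a ha])).2 h1.not_gt
    have hcard : D ≤ (Lᶜ.filter fun i => g k i = v).card := by
      rw [← hDout]
      exact Finset.card_le_card fun i hi =>
        Finset.mem_filter.2 ⟨Finset.mem_compl.2 (Finset.mem_sdiff.1 hi).2, hv1 i hi⟩
    have := H.compat.neg.card_le_forward (Lᶜ.filter fun i => g k i = v) y (k + 1) (m - (k + 1))
      (fun j hj hj' => (neg_injective.comp_injOn
        (hinj j (by omega) (by omega) _ fun i hi => (Finset.mem_filter.1 hi).2)))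
      (fun b hb => neg_lt_neg (H.compat k b y (by rwa [(Finset.mem_filter.1 hb).2])).2)
      (fun b hb => by rw [ek]; exact neg_le_neg (hy b (Finset.mem_filter.1 hb).1))
    omega
  have hxv' : g l x = v' := by
    by_contra hne
    have hlt : g l x < v' := by
      obtain ⟨a, ha⟩ := Finset.card_pos.1 (hl.trans_eq hDin'.symm)
      have h1 : h l x < h l a :=
        lt_of_mem_lowest (hLl ▸ hxL) (hLl ▸ (Finset.mem_sdiff.1 ha).2)
      refine lt_of_le_of_ne (le_of_not_gt fun h2 => ?_) hne
      exact absurd (H.compat l a x (by rwa [hv2' a ha])).1 h1.not_gt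
    have hcard : D' ≤ (L.filter fun i => g l i = v').card := by
      rw [← hDout']
      exact Finset.card_le_card fun i hi =>
        Finset.mem_filter.2 ⟨(Finset.mem_sdiff.1 hi).1, hv1' i hi⟩
    have := H.compat.card_le_backward (L.filter fun i => g l i = v') x m (l - m)
      (fun j hj hj' => hinj' j (by omega) (by omega) _ fun i hi => (Finset.mem_filter.1 hi).2)
      (fun b hb => by
        rw [el]
        exact (H.compat l x b (by rwa [(Finset.mem_filter.1 hb).2])).1)
      (fun b hb => hx b (Finset.mem_filter.1 hb).1)
    omega
  have hyv' : g l y = v' := by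
    by_contra hne
    have hlt : v' < g l y := by
      obtain ⟨a, ha⟩ := Finset.card_pos.1 (hl.trans_eq hDout'.symm)
      have h1 : h l a < h l y :=
        lt_of_mem_lowest (hLl ▸ (Finset.mem_sdiff.1 ha).1) (hLl ▸ Finset.mem_compl.1 hyL)
      refine lt_of_le_of_ne (le_of_not_gt fun h2 => ?_) (Ne.symm hne)
      exact absurd (H.compat l y a (by rwa [hv1' a ha])).1 h1.not_gt
    have hcard : D' ≤ (Lᶜ.filter fun i => g l i = v').card := by
      rw [← hDin']
      exact Finset.card_le_card fun i hi =>
        Finset.mem_filter.2 ⟨Finset.mem_compl.2 (Finset.mem_sdiff.1 hi).2, hv2' i hi⟩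
    have := H.compat.neg.card_le_backward (Lᶜ.filter fun i => g l i = v') y m (l - m)
      (fun j hj hj' => (neg_injective.comp_injOn
        (hinj' j (by omega) (by omega) _ fun i hi => (Finset.mem_filter.1 hi).2)))
      (fun b hb => by
        rw [el]
        exact neg_lt_neg (H.compat l b y (by rwa [(Finset.mem_filter.1 hb).2])).1)
      (fun b hb => neg_le_neg (hy b (Finset.mem_filter.1 hb).1))
    omega
  have hxy : x ≠ y := by
    rintro rfl
    exact Finset.mem_compl.1 hyL hxL
  have := H.tie k l x y hxy (hxv.trans hyv.symm) (hxv'.trans hyv'.symm) hkl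
  omega

/-- `crossing_add_le` summed over consecutive crossings: interior terms count twice, the two end
terms once. -/
theorem CyclicOrders.sum_crossing_le (H : CyclicOrders h g t) (hN0 : 0 < N) (hN : 2 * N ≤ Fintype.card ι) {k : ℕ}
    (hk : 0 < crossing N h k) {l : ℕ} (hkl : k ≤ l) (hl : 0 < crossing N h l) :
    crossing N h l + 2 * ∑ j ∈ Finset.range l, crossing N h j + k ≤
      l + 2 * ∑ j ∈ Finset.range k, crossing N h j + crossing N h k := by
  induction l using Nat.strong_induction_on with
  | _ l ih =>
    rcases hkl.eq_or_lt with rfl | hlt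
    · omega
    obtain ⟨p, hp, hpmax⟩ := Finset.exists_max_image
      ((Finset.Ico k l).filter fun j => 0 < crossing N h j) id
      ⟨k, Finset.mem_filter.2 ⟨Finset.mem_Ico.2 ⟨le_rfl, hlt⟩, hk⟩⟩
    simp only [Finset.mem_filter, Finset.mem_Ico, id] at hp hpmax
    have hzero : ∀ j, p < j → j < l → crossing N h j = 0 := by
      intro j hj hj'
      by_contra hne
      have := hpmax j ⟨⟨by omega, hj'⟩, Nat.pos_of_ne_zero hne⟩
      omega
    have hlp : l < p + t := by
      obtain ⟨q, hq1, hq2, hq3⟩ := H.exists_next hN0 hN hp.2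
      by_contra! hle
      have := hzero q hq1 (by omega)
      omega
    have h1 := ih p hp.1.2 hp.1.1 hp.2
    have h2 := H.crossing_add_le hN0 hN hp.1.2 hlp hp.2 hl hzero
    have h3 : ∑ j ∈ Finset.range l, crossing N h j =
        ∑ j ∈ Finset.range p, crossing N h j + crossing N h p := by
      rw [← Finset.sum_range_succ]
      refine (Finset.sum_subset (Finset.range_mono (by omega)) fun j hj hj' => ?_).symm
      simp only [Finset.mem_range] at hj hj'
      exact hzero j (by omega) hj
    omega

/-- Half a period reverses the order, so the `N` lowest places are then filled by `N` new points,
each of which has crossed. -/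
theorem CyclicOrders.le_sum_crossing (H : CyclicOrders h g t) (hN : 2 * N ≤ Fintype.card ι) (k : ℕ) :
    N + ∑ j ∈ Finset.range k, crossing N h j ≤ ∑ j ∈ Finset.range (k + t), crossing N h j := by
  have key : ∀ n, (lowest N (h (k + n)) \ lowest N (h k)).card +
      ∑ j ∈ Finset.range k, crossing N h j ≤ ∑ j ∈ Finset.range (k + n), crossing N h j := by
    intro n
    induction n with
    | zero => simp
    | succ n ih =>
      rw [← add_assoc, Finset.sum_range_succ]
      have h1 : lowest N (h (k + n + 1)) \ lowest N (h k) ⊆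
          (lowest N (h (k + n + 1)) \ lowest N (h (k + n))) ∪
            (lowest N (h (k + n)) \ lowest N (h k)) := by
        intro i hi
        simp only [Finset.mem_sdiff, Finset.mem_union] at hi ⊢
        tauto
      have h2 := (Finset.card_le_card h1).trans (Finset.card_union_le _ _)
      have h3 : (lowest N (h (k + n + 1)) \ lowest N (h (k + n))).card =
        crossing N h (k + n) := rfl
      omega
  have h1 := key t
  rwa [H.period, Finset.sdiff_eq_self_of_disjoint (disjoint_lowest_neg (H.inj k) hN).symm,
    ← H.period, card_lowest (H.inj _) (by omega)] at h1

end crossing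

/-- The combinatorial core of Ungar's theorem on the number of directions. -/
theorem CyclicOrders.card_le {h g : ℕ → ι → ℝ} {t : ℕ} (H : CyclicOrders h g t) :
    Fintype.card ι ≤ t + 1 := by
  classical
  set N := Fintype.card ι / 2 with hNdef
  have hN : 2 * N ≤ Fintype.card ι := by omega
  have ht := H.pos
  rcases Nat.eq_zero_or_pos N with h0 | hN0
  · omega
  obtain ⟨k, hk⟩ : ∃ k, 0 < crossing N h k := by
    by_contra! hno
    have h1 := H.le_sum_crossing hN 0
    have h2 : ∑ j ∈ Finset.range (0 + t), crossing N h j = 0 :=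
      Finset.sum_eq_zero fun j _ => Nat.le_zero.1 (hno j)
    omega
  have hper : crossing N h (k + t + t) = crossing N h k := by
    have h1 : ∀ k, h (k + t + t) = h k := fun k => by rw [H.period, H.period, neg_neg]
    have h2 : k + t + t + 1 = k + 1 + t + t := by ring
    rw [crossing, h2, h1, h1]
    rfl
  -- Over a full period `2t` the end terms cancel, and the crossings total at most `t` but at least
  -- `2N`. So `2N ≤ t`, and `card ι ≤ 2N + 1`.
  have h1 := H.sum_crossing_le hN0 hN hk (l := k + t + t) (by omega) (hk.trans_eq hper.symm)
  have h2 := H.le_sum_crossing hN k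
  have h3 := H.le_sum_crossing hN (k + t)
  omega

end Ungar

/-! ### Ungar's theorem: from slopes to cyclic orders -/

namespace Ungar

section slopes

variable {ι : Type*} (X Y : ι → ℝ) (s : ℕ → ℝ)

/-- The height of the points above lines of slope `s r`. -/
def lineHeight (r : ℕ) (i : ι) : ℝ := Y i - s r * X i

/-- The height of the points above lines of slope between `s (r - 1)` and `s r`. -/
noncomputable def midHeight (r : ℕ) (i : ι) : ℝ :=
  if r = 0 then X i else Y i - (s (r - 1) + s r) / 2 * X i

variable {X Y s} {t : ℕ}

/-- A pair of points changes order only at its own slope `s q`. The order by `X` at `r = 0` plays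
the role of slope `-∞`, and that by `-X` after the last slope that of `+∞`. -/
theorem midHeight_lt_of_lineHeight_lt (hs : ∀ a b, a < b → b < t → s a < s b)
    (hXY : ∀ i j, i ≠ j → ∃ q < t, Y j - Y i = s q * (X j - X i)) {r : ℕ} (hr : r < t) {i j : ι}
    (hij : lineHeight X Y s r i < lineHeight X Y s r j) :
    midHeight X Y s r i < midHeight X Y s r j ∧
      (r + 1 < t → midHeight X Y s (r + 1) i < midHeight X Y s (r + 1) j) ∧
      (r + 1 = t → X j < X i) := by
  have hne : i ≠ j := by
    rintro rfl
    exact lt_irrefl _ hij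
  obtain ⟨q, hq, he⟩ := hXY i j hne
  simp only [lineHeight] at hij
  have hpos : 0 < (s q - s r) * (X j - X i) := by linarith
  rcases lt_trichotomy q r with h | rfl | h
  · have h1 := hs q r h hr
    have hX : X j - X i < 0 := by
      by_contra! h2
      nlinarith
    have h3 : s q ≤ s (r - 1) := by
      rcases (show q ≤ r - 1 by omega).eq_or_lt with h4 | h4
      · rw [h4]
      · exact (hs _ _ h4 (by omega)).le
    have h4 : s (r - 1) < s r := hs _ _ (by omega) hr
    refine ⟨?_, fun h5 => ?_, fun _ => by linarith⟩
    · simp only [midHeight, show r ≠ 0 by omega, if_false]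
      nlinarith
    · have h6 := hs r (r + 1) (by omega) h5
      simp only [midHeight, Nat.succ_ne_zero, if_false, Nat.add_sub_cancel]
      nlinarith
  · simp at hpos
  · have h1 := hs r q h hq
    have hX : 0 < X j - X i := by
      by_contra! h2
      nlinarith
    refine ⟨?_, fun h5 => ?_, fun _ => by omega⟩
    · simp only [midHeight]
      split_ifs with h0
      · linarith
      · have h4 : s (r - 1) < s r := hs _ _ (by omega) hr
        nlinarith
    · have h6 := hs r (r + 1) (by omega) h5
      have h3 : s (r + 1) ≤ s q := by
        rcases (show r + 1 ≤ q by omega).eq_or_lt with h4 | h4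
        · rw [h4]
        · exact (hs _ _ h4 hq).le
      simp only [midHeight, Nat.succ_ne_zero, if_false, Nat.add_sub_cancel]
      nlinarith

theorem midHeight_injective (hs : ∀ a b, a < b → b < t → s a < s b) (hX : Function.Injective X)
    (hXY : ∀ i j, i ≠ j → ∃ q < t, Y j - Y i = s q * (X j - X i)) {r : ℕ} (hr : r < t) :
    Function.Injective (midHeight X Y s r) := by
  intro i j h
  by_contra hne
  obtain ⟨q, hq, he⟩ := hXY i j hne
  have hX0 : X j - X i ≠ 0 := sub_ne_zero.2 (hX.ne (Ne.symm hne))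
  simp only [midHeight] at h
  split_ifs at h with h0
  · exact hne (hX h)
  have h1 : s q = (s (r - 1) + s r) / 2 := by
    refine mul_right_cancel₀ hX0 ?_
    linarith
  have h4 : s (r - 1) < s r := hs _ _ (by omega) hr
  rcases lt_or_ge q r with h | h
  · have h3 : s q ≤ s (r - 1) := by
      rcases (show q ≤ r - 1 by omega).eq_or_lt with h5 | h5
      · rw [h5]
      · exact (hs _ _ h5 (by omega)).le
    linarith
  · have h3 : s r ≤ s q := by
      rcases h.eq_or_lt with h5 | h5
      · rw [h5]
      · exact (hs _ _ h5 hq).le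
    linarith

/-- Rotating the line by a half turn passes all `t` slopes and reverses the order, hence the sign
`(-1) ^ (k / t)`. Two points are tied only at their own slope, once in each half turn. -/
theorem cyclicOrders_of_slopes (hs : ∀ a b, a < b → b < t → s a < s b)
    (hX : Function.Injective X) (hXY : ∀ i j, i ≠ j → ∃ q < t, Y j - Y i = s q * (X j - X i))
    (ht : 0 < t) (hnc : ∀ a b : ℝ, ∃ i, Y i - a * X i ≠ b) :
    CyclicOrders (fun k i => (-1) ^ (k / t) * midHeight X Y s (k % t) i)
      (fun k i => (-1) ^ (k / t) * lineHeight X Y s (k % t) i) t := by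
  have hsign : ∀ n : ℕ, ((-1 : ℝ) ^ n) ≠ 0 := fun n => pow_ne_zero _ (by norm_num)
  refine ⟨fun k i j hij => ?_, fun k i j hij => ?_, fun k l i j hne h1 h2 hkl => ?_, fun k => ?_,
    ht, fun k v => ?_⟩
  · exact midHeight_injective hs hX hXY (Nat.mod_lt k ht) (mul_left_cancel₀ (hsign _) hij)
  · have hr := Nat.mod_lt k ht
    have hsucc : ∀ i, (-1 : ℝ) ^ ((k + 1) / t) * midHeight X Y s ((k + 1) % t) i =
        (-1) ^ (k / t) * if k % t + 1 < t then midHeight X Y s (k % t + 1) i else - X i := by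
      intro i
      have hdm := Nat.div_add_mod k t
      split_ifs with h
      · obtain ⟨e1, e2⟩ := (Nat.div_mod_unique (a := k + 1) (d := k / t) (c := k % t + 1) ht).2
          ⟨by omega, h⟩
        rw [e1, e2]
      · obtain ⟨e1, e2⟩ := (Nat.div_mod_unique (a := k + 1) (d := k / t + 1) (c := 0) ht).2
          ⟨by rw [mul_add]; omega, ht⟩
        rw [e1, e2, midHeight, if_pos rfl, pow_succ]
        ring
    beta_reduce at hij ⊢
    rw [hsucc, hsucc]
    rcases neg_one_pow_eq_or ℝ (k / t) with h | h
    · rw [h] at hij ⊢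
      simp only [one_mul] at hij ⊢
      obtain ⟨h1, h2, h3⟩ := midHeight_lt_of_lineHeight_lt hs hXY hr hij
      refine ⟨h1, ?_⟩
      split_ifs with h4
      · exact h2 h4
      · exact neg_lt_neg (h3 (by omega))
    · rw [h] at hij ⊢
      simp only [neg_one_mul, neg_lt_neg_iff] at hij ⊢
      obtain ⟨h1, h2, h3⟩ := midHeight_lt_of_lineHeight_lt hs hXY hr hij
      refine ⟨h1, ?_⟩
      split_ifs with h4
      · exact h2 h4
      · exact neg_lt_neg (h3 (by omega))
  · have h1 := mul_left_cancel₀ (hsign _) h1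
    have h2 := mul_left_cancel₀ (hsign _) h2
    simp only [lineHeight] at h1 h2
    have hX0 : X i - X j ≠ 0 := sub_ne_zero.2 (hX.ne hne)
    have h3 : s (k % t) = s (l % t) := by
      refine mul_right_cancel₀ hX0 ?_
      linarith
    have h4 : k % t = l % t := by
      rcases lt_trichotomy (k % t) (l % t) with h | h | h
      · exact absurd h3 (hs _ _ h (Nat.mod_lt l ht)).ne
      · exact h
      · exact absurd h3 (hs _ _ h (Nat.mod_lt k ht)).ne'
    have h5 : t ∣ l - k := (Nat.modEq_iff_dvd' hkl.le).1 h4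
    have := Nat.le_of_dvd (by omega) h5
    omega
  · funext i
    simp only [Pi.neg_apply, Nat.add_mod_right, Nat.add_div_right k ht, pow_succ]
    ring
  · obtain ⟨i, hi⟩ := hnc (s (k % t)) (((-1) ^ (k / t))⁻¹ * v)
    refine ⟨i, fun h => hi ?_⟩
    rw [← h, inv_mul_cancel_left₀ (hsign _)]
    rfl

end slopes

/-- A weak form of Ungar's theorem: `n` points that are not collinear determine at least `n - 1`
directions. -/
theorem card_le_card_directions_add_one {E : Type*} [AddCommGroup E] [Module ℝ E]
    (P U : Finset E) (X : E →ₗ[ℝ] ℝ) (hX : Set.InjOn X P)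
    (hU : ∀ x ∈ P, ∀ y ∈ P, x ≠ y → ∃ u ∈ U, ∃ c : ℝ, x - y = c • u)
    (hP : ∃ p ∈ P, ∃ v ∈ P, ∃ w ∈ P, X (w - p) • (v - p) ≠ X (v - p) • (w - p)) :
    P.card ≤ U.card + 1 := by
  classical
  obtain ⟨p, hp, v, hv, w, hw, hne⟩ := hP
  obtain ⟨Y, hY⟩ : ∃ Y : E →ₗ[ℝ] ℝ, Y (X (w - p) • (v - p) - X (v - p) • (w - p)) ≠ 0 := by
    by_contra! h
    exact hne (sub_eq_zero.1 ((Module.forall_dual_apply_eq_zero_iff ℝ _).1 h))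
  set T : Finset ℝ := U.image fun u => Y u / X u with hT
  have hTU : T.card ≤ U.card := Finset.card_image_le
  have hslope : ∀ i j : P, i ≠ j → ∃ σ ∈ T, Y j - Y i = σ * (X j - X i) := by
    intro i j hij
    obtain ⟨u, hu, c, hc⟩ := hU j j.2 i i.2 (fun h => hij (Subtype.ext h.symm))
    refine ⟨Y u / X u, Finset.mem_image_of_mem _ hu, ?_⟩
    have hX0 : X j - X i ≠ 0 := sub_ne_zero.2 fun h => hij (Subtype.ext (hX j.2 i.2 h).symm)
    rw [← map_sub, ← map_sub, hc, map_smul, map_smul, smul_eq_mul, smul_eq_mul]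
    rw [← map_sub, hc, map_smul, smul_eq_mul] at hX0
    have := right_ne_zero_of_mul hX0
    field_simp
  -- The slopes in increasing order; the value `0` beyond `T.card` plays no role.
  let s : ℕ → ℝ := fun k => if hk : k < T.card then T.orderEmbOfFin rfl ⟨k, hk⟩ else 0
  have hs : ∀ a b, a < b → b < T.card → s a < s b := by
    intro a b hab hb
    simp only [s, hb, hab.trans hb, dite_true]
    exact (T.orderEmbOfFin rfl).strictMono hab
  have hsT : ∀ σ ∈ T, ∃ q < T.card, s q = σ := by
    intro σ hσ
    have : σ ∈ Set.range (T.orderEmbOfFin rfl) := by rw [Finset.range_orderEmbOfFin]; exact hσ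
    obtain ⟨q, hq⟩ := this
    exact ⟨q, q.2, by simp [s, hq]⟩
  have hvw : v ≠ w := by
    rintro rfl
    exact hne rfl
  have hT0 : 0 < T.card := by
    obtain ⟨σ, hσ, -⟩ := hslope ⟨v, hv⟩ ⟨w, hw⟩ fun h => hvw (congrArg Subtype.val h)
    exact Finset.card_pos.2 ⟨σ, hσ⟩
  have H := cyclicOrders_of_slopes (ι := P) (X := fun i => X i) (Y := fun i => Y i) hs
    (fun i j h => Subtype.ext (hX i.2 j.2 h))
    (fun i j hij => by
      obtain ⟨σ, hσ, h⟩ := hslope i j hij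
      obtain ⟨q, hq, rfl⟩ := hsT σ hσ
      exact ⟨q, hq, h⟩) hT0
    (fun a b => by
      by_contra! h
      have h1 := h ⟨p, hp⟩
      have h2 := h ⟨v, hv⟩
      have h3 := h ⟨w, hw⟩
      refine hY ?_
      simp only [map_sub, map_smul, smul_eq_mul]
      have e1 : Y v - Y p = a * (X v - X p) := by linarith
      have e2 : Y w - Y p = a * (X w - X p) := by linarith
      rw [e1, e2]
      ring)
  have h1 := H.card_le
  rw [Fintype.card_coe] at h1
  omega

end Ungar

/-- On each side the positive coefficient sits at the first index and the negative one at the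
second, and independence makes the coefficients agree. -/
theorem LinearIndependent.eq_and_eq_of_smul_sub_eq {F V ι : Type*} [Field F] [LinearOrder F]
    [IsStrictOrderedRing F] [AddCommGroup V] [Module F V] {v : ι → V}
    (hv : LinearIndependent F v) {a b a' b' : ι} {α β : F} (hα : 0 < α) (hβ : 0 < β) (hab : a ≠ b)
    (h : α • (v a - v b) = β • (v a' - v b')) : a = a' ∧ b = b' := by
  classical
  have h0 := linearIndependent_iff.1 hv (Finsupp.single a α - Finsupp.single b α -
    (Finsupp.single a' β - Finsupp.single b' β)) (by
      simp only [map_sub, Finsupp.linearCombination_single]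
      rw [← smul_sub, ← smul_sub, h, sub_self])
  constructor
  · by_contra hne
    have := DFunLike.congr_fun h0 a
    simp only [Finsupp.coe_sub, Pi.sub_apply, Finsupp.single_apply, if_true, hab.symm, if_false,
      Ne.symm hne, Finsupp.coe_zero, Pi.zero_apply] at this
    split_ifs at this <;> linarith
  · by_contra hne
    have := DFunLike.congr_fun h0 b
    simp only [Finsupp.coe_sub, Pi.sub_apply, Finsupp.single_apply, if_true, hab, if_false,
      Ne.symm hne, Finsupp.coe_zero, Pi.zero_apply] at this
    split_ifs at this <;> linarith

/-! ### Counting distances for a norm that is not exceptional -/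

namespace DNorm

variable {d : ℕ}

open Classical in
theorem numDistances_eq_card (N : DNorm d) (P : Finset (Pt d)) :
    N.numDistances P = (P.offDiag.image fun q => N.val (q.1 - q.2)).card := by
  rw [numDistances, ← Set.ncard_coe_finset]
  congr 1
  ext r
  simp only [Set.mem_ofPred_eq, Finset.coe_image, Set.mem_image, Finset.mem_coe,
    Finset.mem_offDiag, Prod.exists]
  constructor
  · rintro ⟨x, hx, y, hy, hxy, h⟩
    exact ⟨x, y, ⟨hx, hy, hxy⟩, h⟩
  · rintro ⟨x, y, ⟨hx, hy, hxy⟩, h⟩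
    exact ⟨x, hx, y, hy, hxy, h⟩

/-- On a line all other points lie on one side of the `X`-minimal point `p`, so their distances from
`p` are distinct for every norm. -/
theorem card_le_numDistances_add_one_of_collinear (N : DNorm d) (P : Finset (Pt d))
    (X : Pt d →ₗ[ℝ] ℝ) (hX : Set.InjOn X P)
    (hP : ∀ p ∈ P, ∀ v ∈ P, ∀ w ∈ P, X (w - p) • (v - p) = X (v - p) • (w - p)) :
    P.card ≤ N.numDistances P + 1 := by
  classical
  rcases P.eq_empty_or_nonempty with rfl | hne
  · simp
  obtain ⟨p, hp, hmin⟩ := Finset.exists_min_image P X hne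
  rw [numDistances_eq_card, ← Finset.card_erase_add_one hp]
  refine Nat.add_le_add_right ?_ 1
  refine Finset.card_le_card_of_injOn (fun x => N.val (x - p)) (fun x hx => ?_) ?_
  · obtain ⟨hx1, hx2⟩ := Finset.mem_erase.1 hx
    exact Finset.mem_coe.2 (Finset.mem_image.2 ⟨(x, p), Finset.mem_offDiag.2 ⟨hx2, hp, hx1⟩, rfl⟩)
  · have hpos : ∀ x ∈ P.erase p, 0 < X (x - p) := by
      intro x hx
      obtain ⟨hx1, hx2⟩ := Finset.mem_erase.1 hx
      rw [map_sub, sub_pos]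
      exact lt_of_le_of_ne (hmin x hx2) fun h => hx1 (hX hx2 hp h.symm)
    intro x hx y hy hxy
    have hxy : N.val (x - p) = N.val (y - p) := hxy
    have h1 := congrArg N.val (hP p hp x (Finset.mem_erase.1 hx).2 y (Finset.mem_erase.1 hy).2)
    rw [val_smul, val_smul, abs_of_pos (hpos x hx), abs_of_pos (hpos y hy), hxy] at h1
    have h2 := mul_right_cancel₀ (N.val_pos (sub_ne_zero.2 (Finset.mem_erase.1 hy).1)).ne' h1
    rw [map_sub, map_sub] at h2
    exact hX (Finset.mem_erase.1 hx).2 (Finset.mem_erase.1 hy).2 (by linarith)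

theorem exists_linearMap_injOn (P : Finset (Pt d)) : ∃ X : Pt d →ₗ[ℝ] ℝ, Set.InjOn X P := by
  classical
  obtain ⟨X, hX⟩ := Module.exists_dual_forall_apply_ne_zero (K := ℝ)
    (fun q : P.offDiag => q.1.1 - q.1.2)
    (fun q => sub_ne_zero.2 (Finset.mem_offDiag.1 q.2).2.2)
  refine ⟨X, fun x hx y hy h => ?_⟩
  by_contra hne
  refine hX ⟨(x, y), Finset.mem_offDiag.2 ⟨hx, hy, hne⟩⟩ ?_
  rw [map_sub, h, sub_self]

/-- Here `k` is the dimension of `W` over the field of distances. The same set `U` of unit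
directions is bounded above by genericity and below twice: by Ungar's theorem and by differences of
basis vectors. -/
theorem card_le_of_notMem_exceptional {N : DNorm d} (hN : N ∉ exceptional d)
    (P : Finset (Pt d)) :
    P.card ≤ N.numDistances P + 1 ∨ ∃ k, P.card ≤ d * k + N.numDistances P + 1 ∧
      k * k ≤ 2 * (d * k + N.numDistances P) + k := by
  classical
  obtain ⟨X, hX⟩ := exists_linearMap_injOn P
  by_cases hcol : ∀ p ∈ P, ∀ v ∈ P, ∀ w ∈ P, X (w - p) • (v - p) = X (v - p) • (w - p)
  · exact Or.inl (N.card_le_numDistances_add_one_of_collinear P X hX hcol)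
  right
  push Not at hcol
  obtain ⟨p, hp, -⟩ := id hcol
  set R := P.offDiag.image fun q => N.val (q.1 - q.2) with hR
  have hm : N.numDistances P = R.card := N.numDistances_eq_card P
  rw [hm]
  set r : Fin R.card → ℝ := fun i => R.equivFin.symm i with hr
  set F := Subfield.closure (Set.range r) with hF
  have hRF : ∀ x ∈ P, ∀ y ∈ P, x ≠ y → N.val (x - y) ∈ F := by
    intro x hx y hy hxy
    have h1 : N.val (x - y) ∈ R :=
      Finset.mem_image.2 ⟨(x, y), Finset.mem_offDiag.2 ⟨hx, hy, hxy⟩, rfl⟩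
    refine Subfield.subset_closure ⟨R.equivFin ⟨_, h1⟩, ?_⟩
    simp [hr]
  set Q : Finset (Pt d) := P.image fun x => x - p with hQ
  set W : Submodule F (Pt d) := Submodule.span F (Q : Set (Pt d)) with hW
  have hWfin : Module.Finite F W := Module.Finite.span_of_finite F Q.finite_toSet
  let dir : Pt d × Pt d → Pt d := fun q => (N.val (q.1 - q.2))⁻¹ • (q.1 - q.2)
  -- Positivity of `X` selects one of each pair of opposite directions.
  set U : Finset (Pt d) := (P.offDiag.filter fun q => 0 < X (q.1 - q.2)).image dir with hUdef
  have hXne : ∀ x ∈ P, ∀ y ∈ P, x ≠ y → X (x - y) ≠ 0 := by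
    intro x hx y hy hxy
    rw [map_sub]
    exact sub_ne_zero.2 fun h => hxy (hX hx hy h)
  have hU : ∀ x ∈ P, ∀ y ∈ P, 0 < X (x - y) → dir (x, y) ∈ U := by
    intro x hx y hy h
    have hxy : x ≠ y := by
      rintro rfl
      simp at h
    exact Finset.mem_image_of_mem _ (Finset.mem_filter.2 ⟨Finset.mem_offDiag.2 ⟨hx, hy, hxy⟩, h⟩)
  have hUcase : ∀ u ∈ U, ∃ x ∈ P, ∃ y ∈ P, x ≠ y ∧ 0 < X (x - y) ∧ u = dir (x, y) := by
    intro u hu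
    obtain ⟨⟨x, y⟩, hq, rfl⟩ := Finset.mem_image.1 hu
    obtain ⟨hq1, hq2⟩ := Finset.mem_filter.1 hq
    obtain ⟨hx, hy, hxy⟩ := Finset.mem_offDiag.1 hq1
    exact ⟨x, hx, y, hy, hxy, hq2, rfl⟩
  have hUX : ∀ u ∈ U, 0 < X u := by
    intro u hu
    obtain ⟨x, hx, y, hy, hxy, h, rfl⟩ := hUcase u hu
    have := N.val_pos (sub_ne_zero.2 hxy)
    simp only [dir, map_smul, smul_eq_mul]
    positivity
  have hdirneg : ∀ x y : Pt d, dir (x, y) = - dir (y, x) := by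
    intro x y
    simp only [dir]
    rw [← neg_sub y x, val_neg, smul_neg]
  have hcard1 : U.card ≤ d * Module.finrank F W + R.card := by
    refine card_unitVectors_le hN r W U (fun u hu => ?_) (fun u hu => ?_) fun u hu hu' => ?_
    · obtain ⟨x, hx, y, hy, hxy, h, rfl⟩ := hUcase u hu
      have h1 : x - y ∈ W := by
        rw [← sub_sub_sub_cancel_right x y p]
        exact sub_mem (Submodule.subset_span (Finset.mem_coe.2 (Finset.mem_image_of_mem _ hx)))
          (Submodule.subset_span (Finset.mem_coe.2 (Finset.mem_image_of_mem _ hy)))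
      exact W.smul_mem (⟨_, inv_mem (hRF x hx y hy hxy)⟩ : F) h1
    · obtain ⟨x, hx, y, hy, hxy, h, rfl⟩ := hUcase u hu
      exact N.val_inv_smul_self (sub_ne_zero.2 hxy)
    · have h1 := hUX u hu
      have h2 := hUX _ hu'
      rw [map_neg] at h2
      linarith
  have hcard2 : P.card ≤ U.card + 1 := by
    refine Ungar.card_le_card_directions_add_one P U X hX (fun x hx y hy hxy => ?_) hcol
    have hpos := N.val_pos (sub_ne_zero.2 hxy)
    have hself : x - y = N.val (x - y) • dir (x, y) := by
      simp only [dir]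
      rw [smul_inv_smul₀ hpos.ne']
    rcases lt_or_gt_of_ne (hXne x hx y hy hxy) with h | h
    · refine ⟨dir (y, x), hU y hy x hx ?_, -N.val (x - y), ?_⟩
      · rw [← neg_sub, map_neg]
        linarith
      · rw [neg_smul, ← smul_neg, ← hdirneg]
        exact hself
    · exact ⟨dir (x, y), hU x hx y hy h, N.val (x - y), hself⟩
  obtain ⟨B, hBQ, hBspan, hBli⟩ := exists_linearIndependent F (Q : Set (Pt d))
  have hBfin : B.Finite := Q.finite_toSet.subset hBQ
  set B' := hBfin.toFinset with hB'
  have hBcard : Module.finrank F W = B'.card := by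
    have := hBfin.fintype
    rw [hW, ← hBspan, finrank_span_set_eq_card hBli, hB', Set.Finite.toFinset_eq_toFinset]
  have hBP : ∀ a ∈ B', ∃ x ∈ P, x - p = a := fun a ha =>
    Finset.mem_image.1 (hBQ (hBfin.mem_toFinset.1 ha))
  -- Distinct ordered pairs of basis vectors have distinct directions because their lengths lie in
  -- `F`, over which the basis is independent.
  have hcard3 : B'.offDiag.card ≤ (U ∪ U.image fun u => -u).card := by
    refine Finset.card_le_card_of_injOn dir (fun q hq => ?_) fun q hq q' hq' h => ?_
    · obtain ⟨ha, hb, hab⟩ := Finset.mem_offDiag.1 hq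
      obtain ⟨x, hx, hxa⟩ := hBP _ ha
      obtain ⟨y, hy, hyb⟩ := hBP _ hb
      have hxy : x ≠ y := by
        rintro rfl
        exact hab (hxa.symm.trans hyb)
      have hdir : dir q = dir (x, y) := by
        simp only [dir, ← hxa, ← hyb, sub_sub_sub_cancel_right]
      rw [hdir, Finset.mem_coe, Finset.mem_union]
      rcases lt_or_gt_of_ne (hXne x hx y hy hxy) with h | h
      · right
        refine Finset.mem_image.2 ⟨dir (y, x), hU y hy x hx ?_, (hdirneg x y).symm⟩
        rw [← neg_sub, map_neg]
        linarith
      · exact Or.inl (hU x hx y hy h)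
    · have hval : ∀ q ∈ B'.offDiag, 0 < N.val (q.1 - q.2) ∧ N.val (q.1 - q.2) ∈ F := by
        intro q hq
        obtain ⟨ha, hb, hab⟩ := Finset.mem_offDiag.1 hq
        refine ⟨N.val_pos (sub_ne_zero.2 hab), ?_⟩
        obtain ⟨x, hx, hxa⟩ := hBP _ ha
        obtain ⟨y, hy, hyb⟩ := hBP _ hb
        rw [← hxa, ← hyb, sub_sub_sub_cancel_right]
        refine hRF x hx y hy ?_
        rintro rfl
        exact hab (hxa.symm.trans hyb)
      obtain ⟨ha, hb, hab⟩ := Finset.mem_offDiag.1 hq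
      obtain ⟨ha', hb', -⟩ := Finset.mem_offDiag.1 hq'
      obtain ⟨h1, h2⟩ := hval q hq
      obtain ⟨h3, h4⟩ := hval q' hq'
      have := LinearIndependent.eq_and_eq_of_smul_sub_eq hBli
        (a := ⟨q.1, hBfin.mem_toFinset.1 ha⟩) (b := ⟨q.2, hBfin.mem_toFinset.1 hb⟩)
        (a' := ⟨q'.1, hBfin.mem_toFinset.1 ha'⟩) (b' := ⟨q'.2, hBfin.mem_toFinset.1 hb'⟩)
        (α := ⟨_, inv_mem h2⟩) (β := ⟨_, inv_mem h4⟩) (inv_pos.2 h1) (inv_pos.2 h3)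
        (fun h => hab (congrArg Subtype.val h)) h
      exact Prod.ext (congrArg Subtype.val this.1) (congrArg Subtype.val this.2)
  rw [Finset.offDiag_card] at hcard3
  have hcard4 := hcard3.trans ((Finset.card_union_le _ _).trans
    (Nat.add_le_add_left Finset.card_image_le _))
  rw [← hBcard] at hcard4
  refine ⟨Module.finrank F W, by omega, by omega⟩

/-! ### Asymptotics and conclusion -/

/-- The error term in the lower bound for the number of distances. -/
noncomputable def errorTerm (d n : ℕ) : ℝ := (1 + d * (2 * d + 1) + d * √(2 * n)) / n

theorem tendsto_errorTerm (d : ℕ) : Tendsto (errorTerm d) atTop (𝓝 0) := by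
  have h1 : Tendsto (fun n : ℕ => (1 + (d : ℝ) * (2 * d + 1)) / n) atTop (𝓝 0) :=
    tendsto_const_div_atTop_nhds_zero_nat _
  have h2 : Tendsto (fun n : ℕ => (d * √2) * (√(n : ℝ))⁻¹) atTop (𝓝 0) := by
    have := (tendsto_inv_atTop_zero.comp
      (Real.tendsto_sqrt_atTop.comp tendsto_natCast_atTop_atTop)).const_mul ((d : ℝ) * √2)
    simpa using this
  have h3 := h1.add h2
  rw [add_zero] at h3
  refine h3.congr fun n => ?_
  rw [errorTerm, add_div _ (_ * √_), Real.sqrt_mul (by norm_num), mul_div_assoc, mul_div_assoc,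
    Real.sqrt_div_self', one_div, mul_assoc]

theorem le_numDistances {N : DNorm d} (hN : N ∉ exceptional d) (P : Finset (Pt d)) :
    (1 - errorTerm d P.card) * (P.card : ℝ) ≤ N.numDistances P := by
  rcases Nat.eq_zero_or_pos P.card with h0 | hpos
  · simp [h0]
  have hn : (0 : ℝ) < P.card := by exact_mod_cast hpos
  have hmul : (1 - errorTerm d P.card) * (P.card : ℝ) =
      P.card - (1 + d * (2 * d + 1) + d * √(2 * P.card)) := by
    rw [errorTerm, sub_mul, div_mul_cancel₀ _ hn.ne', one_mul]
  rw [hmul]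
  have hd0 : (0 : ℝ) ≤ d * (2 * d + 1) := by positivity
  have hs0 : (0 : ℝ) ≤ d * √(2 * P.card) := by positivity
  rcases card_le_of_notMem_exceptional hN P with h | ⟨k, h1, h2⟩
  · have h : (P.card : ℝ) ≤ N.numDistances P + 1 := by exact_mod_cast h
    linarith
  rcases le_total (P.card : ℝ) (N.numDistances P) with hle | hle
  · linarith
  have h1 : (P.card : ℝ) ≤ d * k + N.numDistances P + 1 := by exact_mod_cast h1
  have h2 : (k : ℝ) * k ≤ 2 * (d * k + N.numDistances P) + k := by exact_mod_cast h2
  -- From `k * (k - 2d - 1) ≤ 2D ≤ 2n`.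
  have hk : (k : ℝ) ≤ 2 * d + 1 + √(2 * P.card) := by
    by_contra! hlt
    have hs := Real.sqrt_nonneg (2 * (P.card : ℝ))
    have hsq := Real.mul_self_sqrt (show (0 : ℝ) ≤ 2 * P.card by positivity)
    have hdd : (0 : ℝ) ≤ d := by positivity
    have h3 : √(2 * (P.card : ℝ)) < k - (2 * d + 1) := by linarith
    have h4 : √(2 * (P.card : ℝ)) < k := by linarith
    have h5 := mul_lt_mul'' h3 h4 hs hs
    nlinarith
  have h3 : (d : ℝ) * k ≤ d * (2 * d + 1 + √(2 * P.card)) :=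
    mul_le_mul_of_nonneg_left hk (by positivity)
  linarith

/-- An arithmetic progression on a line: every distance is the length of the step times a natural
number below `n`. -/
theorem exists_card_eq_numDistances_le (hd : 2 ≤ d) (N : DNorm d) (n : ℕ) :
    ∃ P : Finset (Pt d), P.card = n ∧ N.numDistances P ≤ n := by
  classical
  have : NeZero d := ⟨by omega⟩
  let v : Pt d := EuclideanSpace.single 0 1
  have hv : v ≠ 0 := by simp [v]
  have hinj : Function.Injective fun i : ℕ => (i : ℝ) • v := by
    intro i j h
    exact_mod_cast smul_left_injective ℝ hv h
  refine ⟨(Finset.range n).image fun i : ℕ => (i : ℝ) • v, ?_, ?_⟩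
  · rw [Finset.card_image_of_injective _ hinj, Finset.card_range]
  rw [numDistances_eq_card]
  refine (Finset.card_le_card (t := (Finset.range n).image fun i : ℕ => (i : ℝ) * N.val v)
    fun r hr => ?_).trans (Finset.card_image_le.trans_eq (Finset.card_range n))
  obtain ⟨⟨x, y⟩, hq, rfl⟩ := Finset.mem_image.1 hr
  obtain ⟨hx, hy, -⟩ := Finset.mem_offDiag.1 hq
  obtain ⟨i, hi, rfl⟩ := Finset.mem_image.1 hx
  obtain ⟨j, hj, rfl⟩ := Finset.mem_image.1 hy
  rw [Finset.mem_range] at hi hj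
  refine Finset.mem_image.2 ⟨((i : ℤ) - j).natAbs, Finset.mem_range.2 (by omega), ?_⟩
  dsimp only
  rw [← sub_smul, val_smul, Nat.cast_natAbs]
  push_cast
  rfl

theorem isEquivalent_minDistances (hd : 2 ≤ d) {N : DNorm d} (hN : N ∉ exceptional d) :
    (fun n : ℕ => (N.minDistances n : ℝ)) ~[atTop] (fun n : ℕ => (n : ℝ)) := by
  have hupper : ∀ n, N.minDistances n ≤ n := by
    intro n
    obtain ⟨P, hP, hle⟩ := exists_card_eq_numDistances_le hd N n
    refine (Nat.sInf_le ?_).trans hle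
    exact ⟨P, hP, rfl⟩
  have hlower : ∀ n, (1 - errorTerm d n) * (n : ℝ) ≤ N.minDistances n := by
    intro n
    obtain ⟨P, hP, -⟩ := exists_card_eq_numDistances_le hd N n
    obtain ⟨P', hP', he⟩ := Nat.sInf_mem
      (s := {k : ℕ | ∃ P : Finset (Pt d), P.card = n ∧ N.numDistances P = k}) ⟨_, P, hP, rfl⟩
    rw [minDistances, ← he, ← hP']
    exact le_numDistances hN P'
  rw [IsEquivalent, isLittleO_iff]
  intro c hc
  filter_upwards [(tendsto_errorTerm d).eventually (eventually_le_nhds hc)] with n hn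
  have h1 : (N.minDistances n : ℝ) ≤ n := by exact_mod_cast hupper n
  have h2 := hlower n
  have h3 : errorTerm d n * n ≤ c * n := mul_le_mul_of_nonneg_right hn (Nat.cast_nonneg n)
  rw [Pi.sub_apply, Real.norm_eq_abs, abs_of_nonpos (by linarith), Real.norm_of_nonneg
    (Nat.cast_nonneg n)]
  linarith

end DNorm

/-- For `d ≥ 2` there is an error term `ε(n) → 0`, depending only on `d`, such that all `d`-norms
outside a meagre set have at least `(1 - ε(n)) n` distinct distances on every set of `n` points,
and satisfy `D(n) = (1 - o(1)) n`. Moreover, some `d`-norm does not satisfy `D(n) = o(n)`. -/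
theorem theorem1p3 (d : ℕ) (hd : 2 ≤ d) :
    (∃ ε : ℕ → ℝ, Tendsto ε atTop (𝓝 0) ∧
      ∃ S : Set (DNorm d), IsMeagre S ∧ ∀ N : DNorm d, N ∉ S →
        (∀ (n : ℕ) (P : Finset (Pt d)), P.card = n →
          (1 - ε n) * (n : ℝ) ≤ (N.numDistances P : ℝ)) ∧
        (fun n : ℕ => (N.minDistances n : ℝ)) ~[atTop] (fun n : ℕ => (n : ℝ))) ∧
    (∃ N : DNorm d,
      ¬ (fun n : ℕ => (N.minDistances n : ℝ)) =o[atTop] (fun n : ℕ => (n : ℝ))) := by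
  refine ⟨⟨DNorm.errorTerm d, DNorm.tendsto_errorTerm d, DNorm.exceptional d,
    DNorm.isMeagre_exceptional d, fun N hN => ⟨?_, DNorm.isEquivalent_minDistances hd hN⟩⟩, ?_⟩
  · rintro n P rfl
    exact DNorm.le_numDistances hN P
  · obtain ⟨N, hN⟩ : ∃ N, N ∉ DNorm.exceptional d := by
      by_contra! h
      have h1 : DNorm.exceptional d = Set.univ := Set.eq_univ_of_forall h
      have h2 := DNorm.isMeagre_exceptional d
      rw [h1] at h2
      -- Baire category; the Euclidean norm only witnesses that the space is nonempty.
      exact not_isMeagre_of_isOpen isOpen_univ ⟨DNorm.euclidean d, trivial⟩ h2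
    refine ⟨N, fun h => ?_⟩
    have h1 := (DNorm.isEquivalent_minDistances hd hN).symm.isBigO.trans_isLittleO h
    refine isLittleO_irrefl (Eventually.frequently ?_) h1
    filter_upwards [eventually_gt_atTop 0] with n hn
    exact_mod_cast hn.ne'
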